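/- Consider the higher-order $\pi$-calculus with passivation (HO$\pi$P), whose processes $P,Q$ and terms $M,N$ are given, up to $\alpha$-conversion, by $$P,Q ::= 0 \mid a(X).P \mid \bar a\langle M\rangle.P \mid (P\mid Q) \mid a[P] \mid \nu a.P \mid {!P} \mid \mathit{run}(M),\qquad M,N ::= X \mid {`P},$$ where $X$ ranges over variables (bound by $a(X).P$), $a$ ranges over an infinite set of names (bound by $\nu a.P$), and $`P$ is the quotation of $P$. Labels are $\tau$, $a(M)$ and $\nu\tilde b.\bar a\langle M\rangle$ (where $\tilde b$ is a possibly empty sequence of bound names, not containing $a$). Transitions between variable-closed processes are defined by the rules * $a(X).P\xrightarrow{a(M)}P\{M/X\}$; $\ \bar a\langle M\rangle.P\xrightarrow{\bar a\langle M\rangle}P$; $\ a[P]\xrightarrow{\bar a\langle `P\rangle}0$; $\ \mathit{run}(`P)\xrightarrow{\tau}P$; * if $P\xrightarrow{\alpha}P'$ then $P\mid Q\xrightarrow{\alpha}P'\mid Q$ and, symmetrically, $Q\mid P\xrightarrow{\alpha}Q\mid P'$, provided that the bound names of $\alpha$ are not free in $Q$; * if $P\xrightarrow{\nu\tilde b.\bar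 a\langle M\rangle}P'$ and $Q\xrightarrow{a(M)}Q'$ with $\tilde b$ not free in $Q$, then $P\mid Q\xrightarrow{\tau}\nu\tilde b.(P'\mid Q')$ and, symmetrically, $Q\mid P\xrightarrow{\tau}\nu\tilde b.(Q'\mid P')$; * if ${!P}\mid P\xrightarrow{\alpha}P'$ then $!P\xrightarrow{\alpha}P'$; * if $P\xrightarrow{\alpha}P'$ and $a$ does not occur in $\alpha$, then $\nu a.P\xrightarrow{\alpha}\nu a.P'$; * if $P\xrightarrow{\nu\tilde b.\bar a\langle M\rangle}P'$, $c\ne a$ and $c$ is free in $M$ and not in $\tilde b$, then $\nu c.P\xrightarrow{\nu(\tilde b,c).\bar a\langle M\rangle}P'$; * if $P\xrightarrow{\alpha}P'$ then $a[P]\xrightarrow{\alpha}a[P']$ (the bound names of $\alpha$ being different from $a$). Write $\Rightarrow$ for the reflexive transitive closure of $\xrightarrow{\tau}$. A process has an input (respectively output) barb on $a$ if it has a transition with a label $a(M)$ (respectively $\nu\tilde b.\bar a\langle M\rangle$). *Reduction-closed barbed equivalence* $\approx$ is the largest symmetric relation on variable-closed processes such that $P\approx Q$ implies: 1. if $P\xrightarrow{\tau}P'$,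 then $Q\Rightarrow Q'$ and $P'\approx Q'$ for some $Q'$; 2. if $P$ has an input (respectively output) barb on $a$, then $Q\Rightarrow Q'$ for some $Q'$ which has an input (respectively output) barb on $a$; 3. $P\mid R\approx Q\mid R$ for every variable-closed process $R$. Then, for every name $c$, $$c(X).\mathit{run}(X)\ \approx\ c(X).\nu a.\bigl(\bar a\langle X\rangle.0\ \mid\ {!\,}\nu f.(f[a(X).\mathit{run}(X)]\mid f(Y).\bar a\langle Y\rangle.0)\bigr),$$ where $a$ and $f$ are distinct names. -/

import Mathlib

/-!
The higher-order pi-calculus with passivation.  Processes are represented up to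
alpha-conversion: names and term variables are both written as de Bruijn indices.
-/

namespace HOpiP

/-- Names, used both for channels and for locations.  In a process, a name `i` under `d`
restrictions refers to the `i`-th enclosing restriction (counted from the inside, from `0`) if
`i < d`, and is the free name `i - d` otherwise; thus there are infinitely many free names. -/
abbrev Name : Type := ℕ

mutual

/-- Processes whose free term variables are among `n` given ones (well-scoped de Bruijn indices).
`Proc 0` is the type of variable-closed processes. -/
inductive Proc : ℕ → Type
  /-- the inert process `0` -/
  | nil {n : ℕ} : Proc n
  /-- input `a(X).P`; the variable `X` is the index `0` of `P` -/
  | inp {n : ℕ} (a : Name) (P : Proc (n + 1)) : Proc n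
  /-- output of the term `M` on `a`, with continuation `P` -/
  | out {n : ℕ} (a : Name) (M : Term n) (P : Proc n) : Proc n
  /-- parallel composition `P | Q` -/
  | par {n : ℕ} (P Q : Proc n) : Proc n
  /-- located process `a[P]` -/
  | loc {n : ℕ} (a : Name) (P : Proc n) : Proc n
  /-- restriction `νa.P`; the name `a` is the index `0` of `P` -/
  | nu {n : ℕ} (P : Proc n) : Proc n
  /-- replication `!P` -/
  | bang {n : ℕ} (P : Proc n) : Proc n
  /-- execution `run(M)` of a term -/
  | run {n : ℕ} (M : Term n) : Proc n

/-- Terms: variables and quoted processes. -/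
inductive Term : ℕ → Type
  /-- a variable -/
  | var {n : ℕ} (x : Fin n) : Term n
  /-- the quotation of a process -/
  | quote {n : ℕ} (P : Proc n) : Term n

end

/-- The extension of a renaming of names to the scope of a restriction. -/
def liftName (ρ : Name → Name) : Name → Name
  | 0 => 0
  | i + 1 => ρ i + 1

/-- The extension of a renaming of variables to the scope of an input. -/
def liftVar {n m : ℕ} (ξ : Fin n → Fin m) : Fin (n + 1) → Fin (m + 1) :=
  Fin.cons 0 (fun i => (ξ i).succ)

mutual

/-- Capture-avoiding renaming of the free names by `ρ` and of the free variables by `ξ`. -/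
def Proc.ren : {n : ℕ} → Proc n → {m : ℕ} → (Name → Name) → (Fin n → Fin m) → Proc m
  | _, .nil, _, _, _ => .nil
  | _, .inp a P, _, ρ, ξ => .inp (ρ a) (P.ren ρ (liftVar ξ))
  | _, .out a M P, _, ρ, ξ => .out (ρ a) (M.ren ρ ξ) (P.ren ρ ξ)
  | _, .par P Q, _, ρ, ξ => .par (P.ren ρ ξ) (Q.ren ρ ξ)
  | _, .loc a P, _, ρ, ξ => .loc (ρ a) (P.ren ρ ξ)
  | _, .nu P, _, ρ, ξ => .nu (P.ren (liftName ρ) ξ)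
  | _, .bang P, _, ρ, ξ => .bang (P.ren ρ ξ)
  | _, .run M, _, ρ, ξ => .run (M.ren ρ ξ)

/-- Capture-avoiding renaming of the free names by `ρ` and of the free variables by `ξ`. -/
def Term.ren : {n : ℕ} → Term n → {m : ℕ} → (Name → Name) → (Fin n → Fin m) → Term m
  | _, .var x, _, _, ξ => .var (ξ x)
  | _, .quote P, _, ρ, ξ => .quote (P.ren ρ ξ)

end

/-- Renaming of the free names of a process. -/
def Proc.renName {n : ℕ} (P : Proc n) (ρ : Name → Name) : Proc n := P.ren ρ id

/-- Renaming of the free names of a term. -/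
def Term.renName {n : ℕ} (M : Term n) (ρ : Name → Name) : Term n := M.ren ρ id

mutual

/-- Capture-avoiding simultaneous substitution of terms for the free variables. -/
def Proc.bind : {n : ℕ} → Proc n → {m : ℕ} → (Fin n → Term m) → Proc m
  | _, .nil, _, _ => .nil
  | _, .inp a P, _, σ => .inp a (P.bind (Fin.cons (.var 0) (fun i => (σ i).ren id Fin.succ)))
  | _, .out a M P, _, σ => .out a (M.bind σ) (P.bind σ)
  | _, .par P Q, _, σ => .par (P.bind σ) (Q.bind σ)
  | _, .loc a P, _, σ => .loc a (P.bind σ)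
  | _, .nu P, _, σ => .nu (P.bind (fun i => (σ i).renName Nat.succ))
  | _, .bang P, _, σ => .bang (P.bind σ)
  | _, .run M, _, σ => .run (M.bind σ)

/-- Capture-avoiding simultaneous substitution of terms for the free variables. -/
def Term.bind : {n : ℕ} → Term n → {m : ℕ} → (Fin n → Term m) → Term m
  | _, .var x, _, σ => σ x
  | _, .quote P, _, σ => .quote (P.bind σ)

end

/-- `P{M/X}`, where `X` is the only free variable of `P` and `M` is variable-closed. -/
def Proc.subst (P : Proc 1) (M : Term 0) : Proc 0 := P.bind (fun _ => M)

mutual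

/-- `P.HasFree x`: the name `x` occurs free in `P`. -/
def Proc.HasFree : {n : ℕ} → Proc n → Name → Prop
  | _, .nil, _ => False
  | _, .inp a P, x => x = a ∨ P.HasFree x
  | _, .out a M P, x => x = a ∨ M.HasFree x ∨ P.HasFree x
  | _, .par P Q, x => P.HasFree x ∨ Q.HasFree x
  | _, .loc a P, x => x = a ∨ P.HasFree x
  | _, .nu P, x => P.HasFree (x + 1)
  | _, .bang P, x => P.HasFree x
  | _, .run M, x => M.HasFree x

/-- `M.HasFree x`: the name `x` occurs free in `M`. -/
def Term.HasFree : {n : ℕ} → Term n → Name → Prop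
  | _, .var _, _ => False
  | _, .quote P, x => P.HasFree x

end

/-- `νb₁ … νbₖ.P` -/
def nus {n : ℕ} : ℕ → Proc n → Proc n
  | 0, P => P
  | k + 1, P => nus k (.nu P)

/-- Transition labels.  In `out k a M`, the process extrudes `k` bound names `b₁, …, bₖ`: this is
the label `(ν b₁, …, bₖ).ā⟨M⟩`.  In `M`, and in the process reached, the indices `0, …, k - 1` are
the extruded names and the index `i + k` is the free name `i` of the source; the channel `a` is
a free name of the source.  For the other labels source and target have the same free names. -/
inductive Act : Type
  /-- internal action -/
  | tau : Act
  /-- input of `M` on `a` -/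
  | inp (a : Name) (M : Term 0) : Act
  /-- output of `M` on `a` with `k` extruded names -/
  | out (k : ℕ) (a : Name) (M : Term 0) : Act

/-- How a free name of the source of a transition is written in its target. -/
def Act.shift : Act → Name → Name
  | .tau, i => i
  | .inp _ _, i => i
  | .out k _ _, i => i + k

/-- How a process that stands beside the source of a transition is written beside its target. -/
def Act.weaken : Act → Proc 0 → Proc 0
  | .tau, P => P
  | .inp _ _, P => P
  | .out k _ _, P => P.renName (· + k)

/-- The renaming that makes room for one further name at the index `k`. -/
def skipName (k : ℕ) (i : Name) : Name := if i < k then i else i + 1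

/-- The renaming that exchanges the order of a block of `k` bound names and the name just outside
of the block: the index `k` becomes `0` and the indices `0, …, k - 1` become `1, …, k`. -/
def rotName (k : ℕ) (i : Name) : Name := if i < k then i + 1 else if i = k then 0 else i

/-- The labelled transition system (early semantics) on variable-closed processes. -/
inductive Step : Proc 0 → Act → Proc 0 → Prop
  | hoIn (a : Name) (P : Proc 1) (M : Term 0) : Step (.inp a P) (.inp a M) (P.subst M)
  | hoOut (a : Name) (M : Term 0) (P : Proc 0) : Step (.out a M P) (.out 0 a M) P
  | parL {P P' : Proc 0} {α : Act} (Q : Proc 0) (h : Step P α P') :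
      Step (.par P Q) α (.par P' (α.weaken Q))
  | parR {Q Q' : Proc 0} {α : Act} (P : Proc 0) (h : Step Q α Q') :
      Step (.par P Q) α (.par (α.weaken P) Q')
  | reactL {P P' Q Q' : Proc 0} {k : ℕ} {a : Name} {M : Term 0}
      (hP : Step P (.out k a M) P')
      (hQ : Step (Q.renName (· + k)) (.inp (a + k) M) Q') :
      Step (.par P Q) .tau (nus k (.par P' Q'))
  | reactR {P P' Q Q' : Proc 0} {k : ℕ} {a : Name} {M : Term 0}
      (hP : Step (P.renName (· + k)) (.inp (a + k) M) P')
      (hQ : Step Q (.out k a M) Q') :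
      Step (.par P Q) .tau (nus k (.par P' Q'))
  | rep {P P' : Proc 0} {α : Act} (h : Step (.par (.bang P) P) α P') : Step (.bang P) α P'
  /- The next three rules are the rule for a restricted name that does not occur in the label. -/
  | guardTau {P P' : Proc 0} (h : Step P .tau P') : Step (.nu P) .tau (.nu P')
  | guardIn {P P' : Proc 0} {a : Name} {M : Term 0}
      (h : Step P (.inp (a + 1) (M.renName Nat.succ)) P') : Step (.nu P) (.inp a M) (.nu P')
  | guardOut {P P' : Proc 0} {k : ℕ} {a : Name} {M : Term 0}
      (h : Step P (.out k (a + 1) (M.renName (skipName k))) P') :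
      Step (.nu P) (.out k a M) (.nu (P'.renName (rotName k)))
  /- Scope extrusion: the restricted name has the index `k` in `M` and in `P'`. -/
  | extr {P P' : Proc 0} {k : ℕ} {a : Name} {M : Term 0}
      (h : Step P (.out k (a + 1) M) P') (hM : M.HasFree k) :
      Step (.nu P) (.out (k + 1) a M) P'
  | transp {P P' : Proc 0} {α : Act} (a : Name) (h : Step P α P') :
      Step (.loc a P) α (.loc (α.shift a) P')
  | passiv (a : Name) (P : Proc 0) : Step (.loc a P) (.out 0 a (.quote P)) .nil
  | run (P : Proc 0) : Step (.run (.quote P)) .tau P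

/-- Weak internal transitions: the reflexive and transitive closure of `Step · tau ·`. -/
def Weak : Proc 0 → Proc 0 → Prop :=
  Relation.ReflTransGen (fun P Q => Step P .tau Q)

/-- `P` has an input barb on `a`. -/
def BarbIn (P : Proc 0) (a : Name) : Prop := ∃ M P', Step P (.inp a M) P'

/-- `P` has an output barb on `a`. -/
def BarbOut (P : Proc 0) (a : Name) : Prop := ∃ k M P', Step P (.out k a M) P'

/-- Symmetric relations on variable-closed processes that are closed under reduction, preserve
barbs, and are preserved by parallel composition with arbitrary variable-closed processes. -/
structure IsRedClosedBarbed (S : Proc 0 → Proc 0 → Prop) : Prop where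
  symm : ∀ {P Q}, S P Q → S Q P
  red : ∀ {P Q P'}, S P Q → Step P .tau P' → ∃ Q', Weak Q Q' ∧ S P' Q'
  barbIn : ∀ {P Q a}, S P Q → BarbIn P a → ∃ Q', Weak Q Q' ∧ BarbIn Q' a
  barbOut : ∀ {P Q a}, S P Q → BarbOut P a → ∃ Q', Weak Q Q' ∧ BarbOut Q' a
  par : ∀ {P Q}, S P Q → ∀ R, S (.par P R) (.par Q R)

/-- Reduction-closed barbed equivalence `P ≈ Q`: the largest relation with the above properties,
that is, the union of all of them. -/
def BarbedEq (P Q : Proc 0) : Prop := ∃ S, IsRedClosedBarbed S ∧ S P Q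

end HOpiP

namespace HOpiP

@[simp] theorem liftName_zero (ρ : Name → Name) : liftName ρ 0 = 0 := rfl
@[simp] theorem liftName_succ (ρ : Name → Name) (i : Name) : liftName ρ (i + 1) = ρ i + 1 := rfl

theorem liftName_id : liftName id = id := by
  funext i; cases i <;> rfl

theorem liftName_comp (ρ ρ' : Name → Name) :
    liftName ρ' ∘ liftName ρ = liftName (ρ' ∘ ρ) := by
  funext i; cases i <;> rfl

theorem liftVar_id {n : ℕ} : liftVar (id : Fin n → Fin n) = id := by
  funext i; refine Fin.cases ?_ (fun j => ?_) i <;> simp [liftVar]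

theorem liftVar_comp {n m l : ℕ} (ξ : Fin n → Fin m) (ξ' : Fin m → Fin l) :
    liftVar ξ' ∘ liftVar ξ = liftVar (ξ' ∘ ξ) := by
  funext i; refine Fin.cases ?_ (fun j => ?_) i <;> simp [liftVar]

mutual

theorem Proc.ren_congr : ∀ {n : ℕ} (P : Proc n) {m : ℕ} {ρ ρ' : Name → Name} (ξ : Fin n → Fin m),
    (∀ x, P.HasFree x → ρ x = ρ' x) → P.ren ρ ξ = P.ren ρ' ξ
  | _, .nil, _, _, _, _, _ => by simp [Proc.ren]
  | _, .inp a P, _, ρ, ρ', ξ, h => by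
    simp only [Proc.ren, h a (by simp [Proc.HasFree])]
    rw [Proc.ren_congr P (liftVar ξ) (fun x hx => h x (by simp [Proc.HasFree, hx]))]
  | _, .out a M P, _, ρ, ρ', ξ, h => by
    simp only [Proc.ren, h a (by simp [Proc.HasFree])]
    rw [Term.ren_congr M ξ (fun x hx => h x (by simp [Proc.HasFree, hx])),
      Proc.ren_congr P ξ (fun x hx => h x (by simp [Proc.HasFree, hx]))]
  | _, .par P Q, _, ρ, ρ', ξ, h => by
    simp only [Proc.ren]
    rw [Proc.ren_congr P ξ (fun x hx => h x (by simp [Proc.HasFree, hx])),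
      Proc.ren_congr Q ξ (fun x hx => h x (by simp [Proc.HasFree, hx]))]
  | _, .loc a P, _, ρ, ρ', ξ, h => by
    simp only [Proc.ren, h a (by simp [Proc.HasFree])]
    rw [Proc.ren_congr P ξ (fun x hx => h x (by simp [Proc.HasFree, hx]))]
  | _, .nu P, _, ρ, ρ', ξ, h => by
    simp only [Proc.ren]
    rw [Proc.ren_congr P ξ (ρ := liftName ρ) (ρ' := liftName ρ') (fun x hx => ?_)]
    cases x with
    | zero => rfl
    | succ x => simp [h x (by simpa [Proc.HasFree] using hx)]
  | _, .bang P, _, ρ, ρ', ξ, h => by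
    simp only [Proc.ren]
    rw [Proc.ren_congr P ξ (fun x hx => h x (by simp [Proc.HasFree, hx]))]
  | _, .run M, _, ρ, ρ', ξ, h => by
    simp only [Proc.ren]
    rw [Term.ren_congr M ξ (fun x hx => h x (by simp [Proc.HasFree, hx]))]

theorem Term.ren_congr : ∀ {n : ℕ} (M : Term n) {m : ℕ} {ρ ρ' : Name → Name} (ξ : Fin n → Fin m),
    (∀ x, M.HasFree x → ρ x = ρ' x) → M.ren ρ ξ = M.ren ρ' ξ
  | _, .var x, _, _, _, _, _ => by simp [Term.ren]
  | _, .quote P, _, ρ, ρ', ξ, h => by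
    simp only [Term.ren]
    rw [Proc.ren_congr P ξ (fun x hx => h x (by simp [Term.HasFree, hx]))]

end

mutual

theorem Proc.ren_id : ∀ {n : ℕ} (P : Proc n), P.ren id id = P
  | _, .nil => by simp [Proc.ren]
  | _, .inp a P => by simp [Proc.ren, liftVar_id, Proc.ren_id P]
  | _, .out a M P => by simp [Proc.ren, Proc.ren_id P, Term.ren_id M]
  | _, .par P Q => by simp [Proc.ren, Proc.ren_id P, Proc.ren_id Q]
  | _, .loc a P => by simp [Proc.ren, Proc.ren_id P]
  | _, .nu P => by simp [Proc.ren, Proc.ren_id P, liftName_id]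
  | _, .bang P => by simp [Proc.ren, Proc.ren_id P]
  | _, .run M => by simp [Proc.ren, Term.ren_id M]

theorem Term.ren_id : ∀ {n : ℕ} (M : Term n), M.ren id id = M
  | _, .var x => by simp [Term.ren]
  | _, .quote P => by simp [Term.ren, Proc.ren_id P]

end

mutual

theorem Proc.ren_ren : ∀ {n : ℕ} (P : Proc n) {m l : ℕ} (ρ ρ' : Name → Name) (ξ : Fin n → Fin m)
    (ξ' : Fin m → Fin l), (P.ren ρ ξ).ren ρ' ξ' = P.ren (ρ' ∘ ρ) (ξ' ∘ ξ)
  | _, .nil, _, _, _, _, _, _ => by simp [Proc.ren]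
  | _, .inp a P, _, _, _, _, _, _ => by simp [Proc.ren, Proc.ren_ren P, liftVar_comp]
  | _, .out a M P, _, _, _, _, _, _ => by simp [Proc.ren, Proc.ren_ren P, Term.ren_ren M]
  | _, .par P Q, _, _, _, _, _, _ => by simp [Proc.ren, Proc.ren_ren P, Proc.ren_ren Q]
  | _, .loc a P, _, _, _, _, _, _ => by simp [Proc.ren, Proc.ren_ren P]
  | _, .nu P, _, _, _, _, _, _ => by simp [Proc.ren, Proc.ren_ren P, liftName_comp]
  | _, .bang P, _, _, _, _, _, _ => by simp [Proc.ren, Proc.ren_ren P]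
  | _, .run M, _, _, _, _, _, _ => by simp [Proc.ren, Term.ren_ren M]

theorem Term.ren_ren : ∀ {n : ℕ} (M : Term n) {m l : ℕ} (ρ ρ' : Name → Name) (ξ : Fin n → Fin m)
    (ξ' : Fin m → Fin l), (M.ren ρ ξ).ren ρ' ξ' = M.ren (ρ' ∘ ρ) (ξ' ∘ ξ)
  | _, .var x, _, _, _, _, _, _ => by simp [Term.ren]
  | _, .quote P, _, _, _, _, _, _ => by simp [Term.ren, Proc.ren_ren P]

end

theorem liftName_eq_succ {ρ : Name → Name} {y x : Name} :
    liftName ρ y = x + 1 ↔ ∃ z, y = z + 1 ∧ ρ z = x := by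
  cases y <;> simp [eq_comm]

mutual

theorem Proc.hasFree_ren : ∀ {n : ℕ} (P : Proc n) {m : ℕ} (ρ : Name → Name) (ξ : Fin n → Fin m)
    (x : Name), (P.ren ρ ξ).HasFree x ↔ ∃ y, P.HasFree y ∧ ρ y = x
  | _, .nil, _, _, _, _ => by simp [Proc.ren, Proc.HasFree]
  | _, .inp a P, _, _, _, _ => by
    simp [Proc.ren, Proc.HasFree, Proc.hasFree_ren P, or_and_right, exists_or, eq_comm]
  | _, .out a M P, _, _, _, _ => by
    simp [Proc.ren, Proc.HasFree, Proc.hasFree_ren P, Term.hasFree_ren M, or_and_right, exists_or,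
      eq_comm]
  | _, .par P Q, _, _, _, _ => by
    simp [Proc.ren, Proc.HasFree, Proc.hasFree_ren P, Proc.hasFree_ren Q, or_and_right, exists_or]
  | _, .loc a P, _, _, _, _ => by
    simp [Proc.ren, Proc.HasFree, Proc.hasFree_ren P, or_and_right, exists_or, eq_comm]
  | _, .nu P, _, ρ, _, x => by
    simp only [Proc.ren, Proc.HasFree, Proc.hasFree_ren P, liftName_eq_succ]
    constructor
    · rintro ⟨_, h, z, rfl, rfl⟩; exact ⟨z, h, rfl⟩
    · rintro ⟨z, h, rfl⟩; exact ⟨_, h, z, rfl, rfl⟩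
  | _, .bang P, _, _, _, _ => by simp [Proc.ren, Proc.HasFree, Proc.hasFree_ren P]
  | _, .run M, _, _, _, _ => by simp [Proc.ren, Proc.HasFree, Term.hasFree_ren M]

theorem Term.hasFree_ren : ∀ {n : ℕ} (M : Term n) {m : ℕ} (ρ : Name → Name) (ξ : Fin n → Fin m)
    (x : Name), (M.ren ρ ξ).HasFree x ↔ ∃ y, M.HasFree y ∧ ρ y = x
  | _, .var x, _, _, _, _ => by simp [Term.ren, Term.HasFree]
  | _, .quote P, _, _, _, _ => by simp [Term.ren, Term.HasFree, Proc.hasFree_ren P]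

end

theorem cons_ren {n m l : ℕ} (σ : Fin n → Term m) (ρ : Name → Name) (ξ : Fin m → Fin l) :
    (fun i => (Fin.cons (.var 0) (fun i => (σ i).ren id Fin.succ) : Fin (n + 1) → Term (m + 1)) i
      |>.ren ρ (liftVar ξ)) =
    Fin.cons (.var 0) (fun i => ((σ i).ren ρ ξ).ren id Fin.succ) := by
  funext i
  refine Fin.cases ?_ (fun j => ?_) i
  · simp [Term.ren, liftVar]
  · simp only [Fin.cons_succ, Term.ren_ren]
    rfl

mutual

theorem Proc.ren_bind : ∀ {n : ℕ} (P : Proc n) {m l : ℕ} (σ : Fin n → Term m) (ρ : Name → Name)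
    (ξ : Fin m → Fin l), (P.bind σ).ren ρ ξ = (P.ren ρ id).bind (fun i => (σ i).ren ρ ξ)
  | _, .nil, _, _, _, _, _ => by simp [Proc.ren, Proc.bind]
  | _, .inp a P, _, _, _, _, _ => by
    simp [Proc.ren, Proc.bind, Proc.ren_bind P, liftVar_id, cons_ren]
  | _, .out a M P, _, _, _, _, _ => by
    simp [Proc.ren, Proc.bind, Proc.ren_bind P, Term.ren_bind M]
  | _, .par P Q, _, _, _, _, _ => by
    simp [Proc.ren, Proc.bind, Proc.ren_bind P, Proc.ren_bind Q]
  | _, .loc a P, _, _, _, _, _ => by simp [Proc.ren, Proc.bind, Proc.ren_bind P]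
  | _, .nu P, _, _, _, _, _ => by
    simp only [Proc.ren, Proc.bind, Proc.ren_bind P, Term.renName, Term.ren_ren]
    rfl
  | _, .bang P, _, _, _, _, _ => by simp [Proc.ren, Proc.bind, Proc.ren_bind P]
  | _, .run M, _, _, _, _, _ => by simp [Proc.ren, Proc.bind, Term.ren_bind M]

theorem Term.ren_bind : ∀ {n : ℕ} (M : Term n) {m l : ℕ} (σ : Fin n → Term m) (ρ : Name → Name)
    (ξ : Fin m → Fin l), (M.bind σ).ren ρ ξ = (M.ren ρ id).bind (fun i => (σ i).ren ρ ξ)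
  | _, .var x, _, _, _, _, _ => by simp [Term.ren, Term.bind]
  | _, .quote P, _, _, _, _, _ => by simp [Term.ren, Term.bind, Proc.ren_bind P]

end

mutual

theorem Proc.hasFree_bind : ∀ {n : ℕ} (P : Proc n) {m : ℕ} (σ : Fin n → Term m) (x : Name),
    (P.bind σ).HasFree x → P.HasFree x ∨ ∃ i, (σ i).HasFree x
  | _, .nil, _, _, _, h => by simp [Proc.HasFree, Proc.bind] at h
  | _, .inp a P, _, σ, x, h => by
    simp only [Proc.HasFree, Proc.bind] at h ⊢
    rcases h with h | h
    · exact .inl (.inl h)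
    rcases Proc.hasFree_bind P _ x h with h | ⟨i, h⟩
    · exact .inl (.inr h)
    revert h
    refine Fin.cases ?_ (fun j => ?_) i
    · simp [Term.HasFree]
    · simp only [Fin.cons_succ, Term.hasFree_ren]
      rintro ⟨y, hy, rfl⟩
      exact .inr ⟨j, hy⟩
  | _, .out a M P, _, σ, x, h => by
    simp only [Proc.HasFree, Proc.bind] at h ⊢
    rcases h with h | h | h
    · exact .inl (.inl h)
    · have := Term.hasFree_bind M σ x h; tauto
    · have := Proc.hasFree_bind P σ x h; tauto
  | _, .par P Q, _, σ, x, h => by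
    simp only [Proc.HasFree, Proc.bind] at h ⊢
    rcases h with h | h
    · have := Proc.hasFree_bind P σ x h; tauto
    · have := Proc.hasFree_bind Q σ x h; tauto
  | _, .loc a P, _, σ, x, h => by
    simp only [Proc.HasFree, Proc.bind] at h ⊢
    rcases h with h | h
    · exact .inl (.inl h)
    · have := Proc.hasFree_bind P σ x h; tauto
  | _, .nu P, _, σ, x, h => by
    simp only [Proc.HasFree, Proc.bind] at h ⊢
    rcases Proc.hasFree_bind P _ _ h with h | ⟨i, h⟩
    · exact .inl h
    · obtain ⟨y, h, hy⟩ := (Term.hasFree_ren _ _ _ _).1 h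
      cases hy
      exact .inr ⟨i, h⟩
  | _, .bang P, _, σ, x, h => by
    simp only [Proc.HasFree, Proc.bind] at h ⊢
    exact Proc.hasFree_bind P σ x h
  | _, .run M, _, σ, x, h => by
    simp only [Proc.HasFree, Proc.bind] at h ⊢
    exact Term.hasFree_bind M σ x h

theorem Term.hasFree_bind : ∀ {n : ℕ} (M : Term n) {m : ℕ} (σ : Fin n → Term m) (x : Name),
    (M.bind σ).HasFree x → M.HasFree x ∨ ∃ i, (σ i).HasFree x
  | _, .var y, _, σ, x, h => .inr ⟨y, by simpa [Term.bind] using h⟩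
  | _, .quote P, _, σ, x, h => by
    simp only [Term.HasFree, Term.bind] at h ⊢
    exact Proc.hasFree_bind P σ x h

end

theorem Proc.renName_renName {n : ℕ} (P : Proc n) (ρ ρ' : Name → Name) :
    (P.renName ρ).renName ρ' = P.renName (ρ' ∘ ρ) := Proc.ren_ren P _ _ _ _

theorem Term.renName_renName {n : ℕ} (M : Term n) (ρ ρ' : Name → Name) :
    (M.renName ρ).renName ρ' = M.renName (ρ' ∘ ρ) := Term.ren_ren M _ _ _ _

@[simp] theorem Proc.renName_id {n : ℕ} (P : Proc n) : P.renName id = P := P.ren_id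

@[simp] theorem Term.renName_id {n : ℕ} (M : Term n) : M.renName id = M := M.ren_id

@[simp] theorem Proc.renName_fun_id {n : ℕ} (P : Proc n) : P.renName (fun x => x) = P := P.ren_id

@[simp] theorem Proc.renName_add_zero {n : ℕ} (P : Proc n) : P.renName (· + 0) = P := P.ren_id

theorem Proc.renName_congr {n : ℕ} {P : Proc n} {ρ ρ' : Name → Name}
    (h : ∀ x, P.HasFree x → ρ x = ρ' x) : P.renName ρ = P.renName ρ' := P.ren_congr _ h

theorem Term.renName_congr {n : ℕ} {M : Term n} {ρ ρ' : Name → Name}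
    (h : ∀ x, M.HasFree x → ρ x = ρ' x) : M.renName ρ = M.renName ρ' := M.ren_congr _ h

theorem Proc.renName_eq_self {n : ℕ} {P : Proc n} {ρ : Name → Name}
    (h : ∀ x, P.HasFree x → ρ x = x) : P.renName ρ = P :=
  (Proc.renName_congr (ρ' := id) h).trans P.renName_id

theorem Term.renName_eq_self {n : ℕ} {M : Term n} {ρ : Name → Name}
    (h : ∀ x, M.HasFree x → ρ x = x) : M.renName ρ = M :=
  (Term.renName_congr (ρ' := id) h).trans M.renName_id

theorem Proc.hasFree_renName {n : ℕ} {P : Proc n} {ρ : Name → Name} {x : Name} :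
    (P.renName ρ).HasFree x ↔ ∃ y, P.HasFree y ∧ ρ y = x := P.hasFree_ren _ _ _

theorem Term.hasFree_renName {n : ℕ} {M : Term n} {ρ : Name → Name} {x : Name} :
    (M.renName ρ).HasFree x ↔ ∃ y, M.HasFree y ∧ ρ y = x := M.hasFree_ren _ _ _

section
variable {n : ℕ} (ρ : Name → Name)

@[simp] theorem renName_nil : (Proc.nil : Proc n).renName ρ = .nil := by
  simp [Proc.renName, Proc.ren]
@[simp] theorem renName_inp (a : Name) (P : Proc (n + 1)) :
    (Proc.inp a P).renName ρ = .inp (ρ a) (P.renName ρ) := by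
  simp [Proc.renName, Proc.ren, liftVar_id]
@[simp] theorem renName_out (a : Name) (M : Term n) (P : Proc n) :
    (Proc.out a M P).renName ρ = .out (ρ a) (M.renName ρ) (P.renName ρ) := by
  simp [Proc.renName, Proc.ren, Term.renName]
@[simp] theorem renName_par (P Q : Proc n) :
    (Proc.par P Q).renName ρ = .par (P.renName ρ) (Q.renName ρ) := by
  simp [Proc.renName, Proc.ren]
@[simp] theorem renName_loc (a : Name) (P : Proc n) :
    (Proc.loc a P).renName ρ = .loc (ρ a) (P.renName ρ) := by
  simp [Proc.renName, Proc.ren]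
@[simp] theorem renName_nu (P : Proc n) :
    (Proc.nu P).renName ρ = .nu (P.renName (liftName ρ)) := by
  simp [Proc.renName, Proc.ren]
@[simp] theorem renName_bang (P : Proc n) : (Proc.bang P).renName ρ = .bang (P.renName ρ) := by
  simp [Proc.renName, Proc.ren]
@[simp] theorem renName_run (M : Term n) : (Proc.run M).renName ρ = .run (M.renName ρ) := by
  simp [Proc.renName, Proc.ren, Term.renName]
@[simp] theorem renName_var (x : Fin n) : (Term.var x).renName ρ = .var x := by
  simp [Term.renName, Term.ren]
@[simp] theorem renName_quote (P : Proc n) :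
    (Term.quote P).renName ρ = .quote (P.renName ρ) := by
  simp [Term.renName, Term.ren, Proc.renName]

end

theorem Proc.renName_subst (P : Proc 1) (M : Term 0) (ρ : Name → Name) :
    (P.subst M).renName ρ = (P.renName ρ).subst (M.renName ρ) := Proc.ren_bind P _ _ _

theorem Proc.hasFree_subst {P : Proc 1} {M : Term 0} {x : Name} (h : (P.subst M).HasFree x) :
    P.HasFree x ∨ M.HasFree x := by
  simpa using Proc.hasFree_bind P _ x h

/-- The extension of a renaming of names to the scope of `k` restrictions. -/
def liftN (k : ℕ) (ρ : Name → Name) (i : Name) : Name := if i < k then i else ρ (i - k) + k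

theorem liftName_apply (ρ : Name → Name) (i : Name) :
    liftName ρ i = if i = 0 then 0 else ρ (i - 1) + 1 := by
  cases i <;> simp

@[simp] theorem liftN_zero (ρ : Name → Name) : liftN 0 ρ = ρ := by
  funext i; simp [liftN]

@[simp] theorem liftN_add (k : ℕ) (ρ : Name → Name) (i : Name) : liftN k ρ (i + k) = ρ i + k := by
  simp [liftN]

theorem liftN_of_lt {k : ℕ} (ρ : Name → Name) {i : Name} (h : i < k) : liftN k ρ i = i := by
  simp [liftN, h]

theorem liftName_liftN (k : ℕ) (ρ : Name → Name) : liftName (liftN k ρ) = liftN (k + 1) ρ := by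
  funext i
  cases i with
  | zero => simp [liftN]
  | succ i => simp [liftN]; split_ifs <;> rfl

theorem liftN_liftName (k : ℕ) (ρ : Name → Name) : liftN k (liftName ρ) = liftN (k + 1) ρ := by
  funext i
  simp only [liftN, liftName_apply]
  by_cases h1 : i < k
  · simp [h1, Nat.lt_succ_of_lt h1]
  · by_cases h2 : i = k
    · simp [h2]
    · have h3 : ¬ i < k + 1 := by lia
      have h4 : i - k ≠ 0 := by lia
      simp only [h1, h3, h4, if_false, Nat.sub_sub]
      lia

theorem liftN_comp (k : ℕ) (ρ ρ' : Name → Name) : liftN k ρ' ∘ liftN k ρ = liftN k (ρ' ∘ ρ) := by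
  funext i
  by_cases h : i < k
  · simp [liftN, h]
  · simp [liftN, h]

theorem liftN_id (k : ℕ) : liftN k id = id := by
  funext i
  simp only [liftN, id]
  split_ifs <;> lia

theorem liftN_comp_add (k : ℕ) (ρ : Name → Name) : liftN k ρ ∘ (· + k) = (· + k) ∘ ρ := by
  funext i; simp

theorem liftN_succ (k : ℕ) : liftN k Nat.succ = skipName k := by
  funext i
  simp only [liftN, skipName]
  split_ifs <;> lia

theorem liftName_comp_succ (ρ : Name → Name) : liftName ρ ∘ Nat.succ = Nat.succ ∘ ρ := rfl

theorem liftN_comp_skipName (k : ℕ) (ρ : Name → Name) :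
    liftN k (liftName ρ) ∘ skipName k = skipName k ∘ liftN k ρ := by
  rw [← liftN_succ, liftN_comp, liftN_comp, liftName_comp_succ]

theorem liftName_comp_rotName (k : ℕ) (ρ : Name → Name) :
    liftName (liftN k ρ) ∘ rotName k = rotName k ∘ liftN k (liftName ρ) := by
  funext i
  rw [liftName_liftN, liftN_liftName]
  by_cases h1 : i < k
  · simp [rotName, liftN, h1, Nat.lt_succ_of_lt h1]
  · by_cases h2 : i = k
    · simp [rotName, liftN, h2]
    · have h3 : ¬ i < k + 1 := by lia
      have h4 : ¬ (ρ (i - (k + 1)) + (k + 1) < k) := by lia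
      have h5 : ρ (i - (k + 1)) + (k + 1) ≠ k := by lia
      simp only [Function.comp, rotName, liftN, h1, h2, h3, h4, h5, if_false]

theorem rotName_comp_skipName (k : ℕ) : rotName k ∘ skipName k = Nat.succ := by
  funext i
  simp only [Function.comp, rotName, skipName]
  split_ifs <;> lia

@[simp] theorem nus_renName {n : ℕ} (k : ℕ) (P : Proc n) (ρ : Name → Name) :
    (nus k P).renName ρ = nus k (P.renName (liftN k ρ)) := by
  induction k generalizing P with
  | zero => simp [nus]
  | succ k ih => simp [nus, ih, liftName_liftN]

theorem hasFree_nus {n : ℕ} (k : ℕ) (P : Proc n) (x : Name) :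
    (nus k P).HasFree x ↔ P.HasFree (x + k) := by
  induction k generalizing P with
  | zero => simp [nus]
  | succ k ih => simp [nus, ih, Proc.HasFree]; rfl

namespace Act

/-- The number of names bound by a label. -/
def bn : Act → ℕ
  | .tau => 0
  | .inp _ _ => 0
  | .out k _ _ => k

/-- Renaming of the free names of a label. -/
def ren (ρ : Name → Name) : Act → Act
  | .tau => .tau
  | .inp a M => .inp (ρ a) (M.renName ρ)
  | .out k a M => .out k (ρ a) (M.renName (liftN k ρ))

/-- The free names of a label that its source provides. -/
def SrcFree : Act → Name → Prop
  | .tau, _ => False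
  | .inp a _, x => x = a
  | .out k a M, x => x = a ∨ M.HasFree (x + k)

/-- The free names of the term received. -/
def RcvFree : Act → Name → Prop
  | .inp _ M, x => M.HasFree x
  | _, _ => False

@[simp] theorem bn_ren (ρ : Name → Name) (α : Act) : (α.ren ρ).bn = α.bn := by cases α <;> rfl

theorem shift_eq (α : Act) (i : Name) : α.shift i = i + α.bn := by cases α <;> rfl

theorem weaken_eq (α : Act) (P : Proc 0) : α.weaken P = P.renName (· + α.bn) := by
  cases α <;> first | rfl | exact P.ren_id.symm

@[simp] theorem weaken_out_zero (a : Name) (M : Term 0) (P : Proc 0) :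
    (Act.out 0 a M).weaken P = P := P.ren_id

theorem ren_ren (ρ ρ' : Name → Name) (α : Act) : (α.ren ρ).ren ρ' = α.ren (ρ' ∘ ρ) := by
  cases α <;> simp [ren, Term.renName_renName, liftN_comp]

theorem ren_id (α : Act) : α.ren id = α := by
  cases α <;> simp [ren, liftN_id]

theorem weaken_ren (α : Act) (ρ : Name → Name) (P : Proc 0) :
    (α.weaken P).renName (liftN α.bn ρ) = (α.ren ρ).weaken (P.renName ρ) := by
  rw [weaken_eq, weaken_eq, Proc.renName_renName, Proc.renName_renName, bn_ren, liftN_comp_add]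

end Act

theorem Proc.renName_add_comm {n : ℕ} (P : Proc n) (k : ℕ) (ρ : Name → Name) :
    (P.renName (· + k)).renName (liftN k ρ) = (P.renName ρ).renName (· + k) := by
  rw [Proc.renName_renName, Proc.renName_renName, liftN_comp_add]

/-- Transitions are preserved by arbitrary renamings of the free names. -/
theorem Step.renName {P P' : Proc 0} {α : Act} (h : Step P α P') (ρ : Name → Name) :
    Step (P.renName ρ) (α.ren ρ) (P'.renName (liftN α.bn ρ)) := by
  induction h generalizing ρ with
  | hoIn a P M =>
    simp only [renName_inp, Act.ren, Act.bn, liftN_zero, Proc.renName_subst]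
    exact .hoIn _ _ _
  | hoOut a M P =>
    simp only [renName_out, Act.ren, Act.bn, liftN_zero]
    exact .hoOut _ _ _
  | parL Q h ih =>
    simp only [renName_par, Act.weaken_ren]
    exact .parL _ (ih ρ)
  | parR Q h ih =>
    simp only [renName_par, Act.weaken_ren]
    exact .parR _ (ih ρ)
  | @reactL P P' Q Q' k a M _ _ ihP ihQ =>
    simp only [renName_par, Act.ren, Act.bn, liftN_zero, nus_renName]
    have h2 := ihQ (liftN k ρ)
    simp only [Proc.renName_add_comm, Act.ren, Act.bn, liftN_zero, liftN_add] at h2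
    exact .reactL (ihP ρ) h2
  | @reactR P P' Q Q' k a M _ _ ihP ihQ =>
    simp only [renName_par, Act.ren, Act.bn, liftN_zero, nus_renName]
    have h2 := ihP (liftN k ρ)
    simp only [Proc.renName_add_comm, Act.ren, Act.bn, liftN_zero, liftN_add] at h2
    exact .reactR h2 (ihQ ρ)
  | rep h ih =>
    simp only [renName_bang]
    exact .rep (by simpa using ih ρ)
  | guardTau h ih =>
    simpa [Act.ren, Act.bn] using Step.guardTau (ih (liftName ρ))
  | guardIn h ih =>
    have h2 := ih (liftName ρ)
    simp only [Act.ren, Act.bn, liftN_zero, Term.renName_renName, liftName_comp_succ,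
      liftName_succ] at h2
    rw [← Term.renName_renName] at h2
    simpa [Act.ren, Act.bn] using Step.guardIn h2
  | @guardOut P P' k a M h ih =>
    have h2 := ih (liftName ρ)
    simp only [Act.ren, Act.bn, Term.renName_renName, liftN_comp_skipName, liftName_succ] at h2
    rw [← Term.renName_renName] at h2
    have h3 := Step.guardOut h2
    simp only [Proc.renName_renName, ← liftName_comp_rotName] at h3
    simpa [Act.ren, Act.bn, Proc.renName_renName] using h3
  | @extr P P' k a M h hM ih =>
    have h2 := ih (liftName ρ)
    simp only [Act.ren, Act.bn, liftName_succ, liftN_liftName] at h2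
    simp only [renName_nu, Act.ren, Act.bn]
    refine .extr h2 (Term.hasFree_renName.2 ⟨k, hM, liftN_of_lt _ (Nat.lt_succ_self k)⟩)
  | transp a h ih =>
    simp only [renName_loc, Act.shift_eq, liftN_add]
    have := Step.transp (ρ a) (ih ρ)
    simpa only [Act.shift_eq, Act.bn_ren] using this
  | passiv a P =>
    simp only [renName_loc, Act.ren, Act.bn, liftN_zero, renName_quote, renName_nil]
    exact .passiv _ _
  | run P =>
    simp only [renName_run, Act.ren, Act.bn, liftN_zero, renName_quote]
    exact .run _

/-- Transitions create no free names. -/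
theorem Step.free {P P' : Proc 0} {α : Act} (h : Step P α P') :
    (∀ x, α.SrcFree x → P.HasFree x) ∧
      ∀ x, P'.HasFree (x + α.bn) → P.HasFree x ∨ α.RcvFree x := by
  induction h with
  | hoIn a P M =>
    refine ⟨fun x hx => .inl hx, fun x hx => ?_⟩
    rcases Proc.hasFree_subst hx with h | h
    · exact .inl (.inr h)
    · exact .inr h
  | hoOut a M P =>
    simp only [Act.SrcFree, Act.bn, Proc.HasFree, Act.RcvFree, add_zero]
    tauto
  | parL Q h ih =>
    refine ⟨fun x hx => .inl (ih.1 x hx), fun x hx => ?_⟩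
    simp only [Act.weaken_eq, Proc.HasFree, Proc.hasFree_renName, add_left_inj,
      exists_eq_right] at hx ⊢
    have := ih.2 x
    tauto
  | parR Q h ih =>
    refine ⟨fun x hx => .inr (ih.1 x hx), fun x hx => ?_⟩
    simp only [Act.weaken_eq, Proc.HasFree, Proc.hasFree_renName, add_left_inj,
      exists_eq_right] at hx ⊢
    have := ih.2 x
    tauto
  | @reactL P P' Q Q' k a M _ _ ihP ihQ =>
    refine ⟨fun x hx => hx.elim, fun x hx => ?_⟩
    simp only [hasFree_nus, Proc.HasFree, Act.bn, add_zero] at hx ⊢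
    have h1 := ihP.1 x
    have h2 := ihP.2 x
    have h3 := ihQ.2 (x + k)
    simp only [Act.SrcFree, Act.RcvFree, Act.bn, Proc.hasFree_renName, add_left_inj,
      exists_eq_right, add_zero] at h1 h2 h3
    tauto
  | @reactR P P' Q Q' k a M _ _ ihP ihQ =>
    refine ⟨fun x hx => hx.elim, fun x hx => ?_⟩
    simp only [hasFree_nus, Proc.HasFree, Act.bn, add_zero] at hx ⊢
    have h1 := ihQ.1 x
    have h2 := ihQ.2 x
    have h3 := ihP.2 (x + k)
    simp only [Act.SrcFree, Act.RcvFree, Act.bn, Proc.hasFree_renName, add_left_inj,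
      exists_eq_right, add_zero] at h1 h2 h3
    tauto
  | rep h ih =>
    simpa only [Proc.HasFree, or_self] using ih
  | guardTau h ih => exact ⟨fun x hx => hx.elim, fun x hx => ih.2 (x + 1) hx⟩
  | guardIn h ih =>
    refine ⟨?_, fun x hx => ?_⟩
    · rintro x rfl; exact ih.1 _ rfl
    · simpa only [Act.RcvFree, Proc.HasFree, Term.hasFree_renName, Nat.succ_eq_add_one, add_left_inj,
        exists_eq_right] using ih.2 (x + 1) hx
  | @guardOut P P' k a M h ih =>
    refine ⟨?_, fun x hx => ?_⟩
    · rintro x (rfl | hx)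
      · exact ih.1 _ (.inl rfl)
      · refine ih.1 (x + 1) (.inr (Term.hasFree_renName.2 ⟨_, hx, ?_⟩))
        simp [skipName]; lia
    · obtain ⟨y, hy, hxy⟩ := Proc.hasFree_renName.1 hx
      have : y = x + 1 + k := by
        simp only [rotName, Act.bn] at hxy
        split_ifs at hxy <;> lia
      subst this
      exact ih.2 (x + 1) hy
  | @extr P P' k a M h hM ih =>
    have e : ∀ x, x + (k + 1) = x + 1 + k := fun x => by lia
    refine ⟨?_, fun x hx => ih.2 (x + 1) ?_⟩
    · rintro x (rfl | hx)
      · exact ih.1 _ (.inl rfl)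
      · exact ih.1 (x + 1) (.inr (by rwa [← e]))
    · simpa only [Act.bn, e] using hx
  | transp a h ih =>
    refine ⟨fun x hx => .inr (ih.1 x hx), fun x hx => ?_⟩
    simp only [Act.shift_eq, Proc.HasFree, add_left_inj] at hx ⊢
    have := ih.2 x
    tauto
  | passiv a P =>
    simp only [Act.SrcFree, Proc.HasFree, Act.RcvFree, Term.HasFree, add_zero]
    tauto
  | run P => exact ⟨fun x hx => hx.elim, fun x hx => .inl hx⟩

/-- Transitions of a process whose free names are renamed injectively. -/
theorem Step.of_renName {P U : Proc 0} {α : Act} {ρ : Name → Name} (hρ : Function.Injective ρ)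
    (h : Step (P.renName ρ) (α.ren ρ) U) :
    ∃ P', Step P α P' ∧ U = P'.renName (liftN α.bn ρ) := by
  obtain ⟨ρ', hl⟩ := hρ.hasLeftInverse
  have e : ρ' ∘ ρ = id := funext hl
  have h2 := h.renName ρ'
  rw [Act.ren_ren, Proc.renName_renName, e, Act.ren_id, Proc.renName_id, Act.bn_ren] at h2
  refine ⟨_, h2, ?_⟩
  rw [Proc.renName_renName, liftN_comp]
  refine (Proc.renName_eq_self fun x hx => ?_).symm
  by_cases hk : x < α.bn
  · exact liftN_of_lt _ hk
  obtain ⟨x, rfl⟩ : ∃ y, x = y + α.bn := ⟨x - α.bn, by lia⟩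
  rw [liftN_add]
  suffices ∃ y, ρ y = x by
    obtain ⟨y, rfl⟩ := this
    simp [hl y]
  rcases h.free.2 x (by rwa [Act.bn_ren]) with h | h
  · obtain ⟨y, -, hy⟩ := Proc.hasFree_renName.1 h
    exact ⟨y, hy⟩
  · cases α with
    | inp a M =>
      obtain ⟨y, -, hy⟩ := Term.hasFree_renName.1 h
      exact ⟨y, hy⟩
    | tau => exact h.elim
    | out => exact h.elim

/-- The channel and, for outputs, the term of a transition of a renamed process are renamed. -/
theorem Step.out_of_renName {P U : Proc 0} {k : ℕ} {b : Name} {N : Term 0} {ρ : Name → Name}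
    (hρ : Function.Injective ρ) (h : Step (P.renName ρ) (.out k b N) U) :
    ∃ (a : Name) (M : Term 0), b = ρ a ∧ N = M.renName (liftN k ρ) := by
  obtain ⟨ρ', hl⟩ := hρ.hasLeftInverse
  obtain ⟨a, -, rfl⟩ := Proc.hasFree_renName.1 (h.free.1 b (.inl rfl))
  refine ⟨a, N.renName (liftN k ρ'), rfl, ?_⟩
  rw [Term.renName_renName, liftN_comp]
  refine (Term.renName_eq_self fun x hx => ?_).symm
  by_cases hk : x < k
  · exact liftN_of_lt _ hk
  obtain ⟨x, rfl⟩ : ∃ y, x = y + k := ⟨x - k, by lia⟩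
  obtain ⟨y, -, rfl⟩ := Proc.hasFree_renName.1 (h.free.1 x (.inr hx))
  simp [hl y]

theorem Step.inp_of_renName {P U : Proc 0} {b : Name} {N : Term 0} {ρ : Name → Name}
    (h : Step (P.renName ρ) (.inp b N) U) : ∃ a, b = ρ a := by
  obtain ⟨a, -, rfl⟩ := Proc.hasFree_renName.1 (h.free.1 b rfl)
  exact ⟨a, rfl⟩

section Inversion

variable {a : Name} {α : Act} {P Q U : Proc 0} {M : Term 0}

theorem not_step_nil (h : Step .nil α U) : False := by
  cases h

theorem step_inp_iff {P : Proc 1} :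
    Step (.inp a P) α U ↔ ∃ M, α = .inp a M ∧ U = P.subst M := by
  constructor
  · intro h; cases h; exact ⟨_, rfl, rfl⟩
  · rintro ⟨M, rfl, rfl⟩; exact .hoIn _ _ _

theorem step_out_iff : Step (.out a M P) α U ↔ α = .out 0 a M ∧ U = P := by
  constructor
  · intro h; cases h; exact ⟨rfl, rfl⟩
  · rintro ⟨rfl, rfl⟩; exact .hoOut _ _ _

theorem step_run_quote_iff : Step (.run (.quote P)) α U ↔ α = .tau ∧ U = P := by
  constructor
  · intro h; cases h; exact ⟨rfl, rfl⟩
  · rintro ⟨rfl, rfl⟩; exact .run _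

theorem step_loc_iff : Step (.loc a P) α U ↔
    (∃ P', Step P α P' ∧ U = .loc (a + α.bn) P') ∨ (α = .out 0 a (.quote P) ∧ U = .nil) := by
  constructor
  · intro h
    cases h with
    | transp _ h => exact .inl ⟨_, h, by rw [Act.shift_eq]⟩
    | passiv => exact .inr ⟨rfl, rfl⟩
  · rintro (⟨P', h, rfl⟩ | ⟨rfl, rfl⟩)
    · rw [← Act.shift_eq]; exact .transp _ h
    · exact .passiv _ _

theorem step_par_cases (h : Step (.par P Q) α U) :
    (∃ P', Step P α P' ∧ U = .par P' (α.weaken Q)) ∨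
    (∃ Q', Step Q α Q' ∧ U = .par (α.weaken P) Q') ∨
    (∃ k a M P' Q', α = .tau ∧ Step P (.out k a M) P' ∧
      Step (Q.renName (· + k)) (.inp (a + k) M) Q' ∧ U = nus k (.par P' Q')) ∨
    ∃ k a M P' Q', α = .tau ∧ Step (P.renName (· + k)) (.inp (a + k) M) P' ∧
      Step Q (.out k a M) Q' ∧ U = nus k (.par P' Q') := by
  cases h with
  | parL _ h => exact .inl ⟨_, h, rfl⟩
  | parR _ h => exact .inr (.inl ⟨_, h, rfl⟩)
  | reactL h1 h2 => exact .inr (.inr (.inl ⟨_, _, _, _, _, rfl, h1, h2, rfl⟩))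
  | reactR h1 h2 => exact .inr (.inr (.inr ⟨_, _, _, _, _, rfl, h1, h2, rfl⟩))

/-- The target of a transition, seen from outside of a restriction that the label does not
mention. -/
def Act.enter : Act → Proc 0 → Proc 0
  | .out k _ _, P => P.renName (rotName k)
  | _, P => P

theorem Step.guard (h : Step P (α.ren Nat.succ) U) : Step (.nu P) α (.nu (α.enter U)) := by
  cases α with
  | tau => exact .guardTau h
  | inp => exact .guardIn h
  | out => exact .guardOut (by simpa only [Act.ren, liftN_succ] using h)

theorem step_nu_cases (h : Step (.nu P) α U) :
    (∃ P', Step P (α.ren Nat.succ) P' ∧ U = .nu (α.enter P')) ∨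
    ∃ k a M, α = .out (k + 1) a M ∧ M.HasFree k ∧ Step P (.out k (a + 1) M) U := by
  cases h with
  | guardTau h => exact .inl ⟨_, h, rfl⟩
  | guardIn h => exact .inl ⟨_, h, rfl⟩
  | guardOut h => exact .inl ⟨_, by simpa only [Act.ren, liftN_succ] using h, rfl⟩
  | extr h hM => exact .inr ⟨_, _, _, rfl, hM, h⟩

end Inversion

theorem Weak.parL {P P' : Proc 0} (h : Weak P P') (Q : Proc 0) : Weak (.par P Q) (.par P' Q) :=
  Relation.ReflTransGen.lift (fun P => Proc.par P Q) (fun _ _ h => by exact Step.parL Q h) _ _ h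

theorem Weak.parR {Q Q' : Proc 0} (h : Weak Q Q') (P : Proc 0) : Weak (.par P Q) (.par P Q') :=
  Relation.ReflTransGen.lift (fun Q => Proc.par P Q) (fun _ _ h => by exact Step.parR P h) _ _ h

theorem Weak.nu {P P' : Proc 0} (h : Weak P P') : Weak (.nu P) (.nu P') :=
  Relation.ReflTransGen.lift Proc.nu (fun _ _ h => by exact Step.guardTau h) _ _ h

/-- The closure of a relation under parallel composition and restriction. -/
inductive EvalClosure (B : Proc 0 → Proc 0 → Prop) : Proc 0 → Proc 0 → Prop
  | base {X Y : Proc 0} (h : B X Y) : EvalClosure B X Y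
  | parL {X Y : Proc 0} (Z : Proc 0) (h : EvalClosure B X Y) :
      EvalClosure B (.par X Z) (.par Y Z)
  | parR {X Y : Proc 0} (Z : Proc 0) (h : EvalClosure B X Y) :
      EvalClosure B (.par Z X) (.par Z Y)
  | nu {X Y : Proc 0} (h : EvalClosure B X Y) : EvalClosure B (.nu X) (.nu Y)

namespace EvalClosure

variable {A B : Proc 0 → Proc 0 → Prop} {X Y : Proc 0}

theorem symm (hB : ∀ {X Y}, B X Y → B Y X) (h : EvalClosure B X Y) : EvalClosure B Y X := by
  induction h with
  | base h => exact .base (hB h)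
  | parL Z _ ih => exact .parL Z ih
  | parR Z _ ih => exact .parR Z ih
  | nu _ ih => exact .nu ih

theorem mono (hAB : ∀ {X Y}, A X Y → B X Y) (h : EvalClosure A X Y) : EvalClosure B X Y := by
  induction h with
  | base h => exact .base (hAB h)
  | parL Z _ ih => exact .parL Z ih
  | parR Z _ ih => exact .parR Z ih
  | nu _ ih => exact .nu ih

theorem renName (hB : ∀ {X Y} (ρ), B X Y → B (X.renName ρ) (Y.renName ρ))
    (h : EvalClosure B X Y) (ρ : Name → Name) :
    EvalClosure B (X.renName ρ) (Y.renName ρ) := by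
  induction h generalizing ρ with
  | base h => exact .base (hB ρ h)
  | parL Z _ ih => simpa using .parL _ (ih ρ)
  | parR Z _ ih => simpa using .parR _ (ih ρ)
  | nu _ ih => simpa using .nu (ih _)

theorem nus (h : EvalClosure B X Y) (k : ℕ) : EvalClosure B (nus k X) (nus k Y) := by
  induction k generalizing X Y with
  | zero => exact h
  | succ k ih => exact ih h.nu

theorem exists_weak (hw : ∀ {X Y}, B X Y → ∃ Y', Weak Y Y' ∧ A X Y') (h : EvalClosure B X Y) :
    ∃ Y', Weak Y Y' ∧ EvalClosure A X Y' := by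
  induction h with
  | base h =>
    obtain ⟨Y', h1, h2⟩ := hw h
    exact ⟨Y', h1, .base h2⟩
  | parL Z _ ih =>
    obtain ⟨Y', h1, h2⟩ := ih
    exact ⟨_, h1.parL Z, .parL Z h2⟩
  | parR Z _ ih =>
    obtain ⟨Y', h1, h2⟩ := ih
    exact ⟨_, h1.parR Z, .parR Z h2⟩
  | nu _ ih =>
    obtain ⟨Y', h1, h2⟩ := ih
    exact ⟨_, h1.nu, .nu h2⟩

/-- A transition with label `α` to a process in `C`; an internal step may also be omitted. -/
def Matches (Y : Proc 0) (α : Act) (C : Proc 0 → Prop) : Prop :=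
  (α = .tau ∧ C Y) ∨ ∃ Y', Step Y α Y' ∧ C Y'

theorem step (hA : ∀ {X Y} (ρ), A X Y → A (X.renName ρ) (Y.renName ρ))
    (hB : ∀ {X Y} (ρ), B X Y → B (X.renName ρ) (Y.renName ρ))
    (hAB : ∀ {X Y}, A X Y → B X Y)
    (hs : ∀ {X Y X' α}, A X Y → Step X α X' → Matches Y α (B X'))
    (h : EvalClosure A X Y) (ρ : Name → Name) {α : Act} {X' : Proc 0}
    (hX : Step (X.renName ρ) α X') : Matches (Y.renName ρ) α (EvalClosure B X') := by
  induction h generalizing ρ α X' with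
  | base h =>
    rcases hs (hA ρ h) hX with ⟨rfl, h⟩ | ⟨Y', h1, h2⟩
    · exact .inl ⟨rfl, .base h⟩
    · exact .inr ⟨Y', h1, .base h2⟩
  | @parL X Y Z hXY ih =>
    rw [renName_par] at hX ⊢
    rcases step_par_cases hX with ⟨P', h, rfl⟩ | ⟨Q', h, rfl⟩ |
      ⟨k, a, M, P', Q', rfl, h1, h2, rfl⟩ | ⟨k, a, M, P', Q', rfl, h1, h2, rfl⟩
    · rcases ih ρ h with ⟨rfl, hC⟩ | ⟨Y', h1, h2⟩
      · exact .inl ⟨rfl, .parL _ hC⟩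
      · exact .inr ⟨_, .parL _ h1, .parL _ h2⟩
    · refine .inr ⟨_, .parR _ h, .parL _ ?_⟩
      rw [Act.weaken_eq, Act.weaken_eq]
      exact ((hXY.mono hAB).renName hB ρ).renName hB _
    · rcases ih ρ h1 with ⟨h, -⟩ | ⟨Y', h3, h4⟩
      · cases h
      · exact .inr ⟨_, .reactL h3 h2, (EvalClosure.parL _ h4).nus k⟩
    · rw [Proc.renName_renName] at h1
      rcases ih _ h1 with ⟨h, -⟩ | ⟨Y', h3, h4⟩
      · cases h
      · rw [← Proc.renName_renName] at h3
        exact .inr ⟨_, .reactR h3 h2, (EvalClosure.parL _ h4).nus k⟩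
  | @parR X Y Z hXY ih =>
    rw [renName_par] at hX ⊢
    rcases step_par_cases hX with ⟨P', h, rfl⟩ | ⟨Q', h, rfl⟩ |
      ⟨k, a, M, P', Q', rfl, h1, h2, rfl⟩ | ⟨k, a, M, P', Q', rfl, h1, h2, rfl⟩
    · refine .inr ⟨_, .parL _ h, .parR _ ?_⟩
      rw [Act.weaken_eq, Act.weaken_eq]
      exact ((hXY.mono hAB).renName hB ρ).renName hB _
    · rcases ih ρ h with ⟨rfl, hC⟩ | ⟨Y', h1, h2⟩
      · exact .inl ⟨rfl, .parR _ hC⟩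
      · exact .inr ⟨_, .parR _ h1, .parR _ h2⟩
    · rw [Proc.renName_renName] at h2
      rcases ih _ h2 with ⟨h, -⟩ | ⟨Y', h3, h4⟩
      · cases h
      · rw [← Proc.renName_renName] at h3
        exact .inr ⟨_, .reactL h1 h3, (EvalClosure.parR _ h4).nus k⟩
    · rcases ih ρ h2 with ⟨h, -⟩ | ⟨Y', h3, h4⟩
      · cases h
      · exact .inr ⟨_, .reactR h1 h3, (EvalClosure.parR _ h4).nus k⟩
  | @nu X Y hXY ih =>
    rw [renName_nu] at hX ⊢
    rcases step_nu_cases hX with ⟨P', h, rfl⟩ | ⟨k, a, M, rfl, hM, h⟩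
    · rcases ih _ h with ⟨h1, h2⟩ | ⟨Y', h1, h2⟩
      · cases α with
        | tau => exact .inl ⟨rfl, .nu h2⟩
        | inp => cases h1
        | out => cases h1
      · refine .inr ⟨_, h1.guard, .nu ?_⟩
        cases α with
        | tau => exact h2
        | inp => exact h2
        | out => exact h2.renName hB _
    · rcases ih _ h with ⟨h1, -⟩ | ⟨Y', h1, h2⟩
      · cases h1
      · exact .inr ⟨_, .extr h1 hM, h2⟩

/-- A criterion for reduction-closed barbed equivalence: the processes related by `B` can silently
get into the relation `A`, in which transitions are matched directly. -/
theorem isRedClosedBarbed (symmB : ∀ {X Y}, B X Y → B Y X)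
    (hA : ∀ {X Y} (ρ), A X Y → A (X.renName ρ) (Y.renName ρ))
    (hB : ∀ {X Y} (ρ), B X Y → B (X.renName ρ) (Y.renName ρ))
    (hAB : ∀ {X Y}, A X Y → B X Y)
    (hw : ∀ {X Y}, B X Y → ∃ Y', Weak Y Y' ∧ A X Y')
    (hs : ∀ {X Y X' α}, A X Y → Step X α X' → Matches Y α (B X')) :
    IsRedClosedBarbed (EvalClosure B) := by
  have key : ∀ {X Y X' α}, EvalClosure B X Y → Step X α X' →
      ∃ Y1, Weak Y Y1 ∧ Matches Y1 α (EvalClosure B X') := by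
    intro X Y X' α h hX
    obtain ⟨Y1, h1, h2⟩ := h.exists_weak (fun h => hw h)
    refine ⟨Y1, h1, ?_⟩
    have := h2.step hA hB hAB hs id (α := α) (X' := X') (by rwa [Proc.renName_id])
    rwa [Proc.renName_id] at this
  refine ⟨fun h => h.symm symmB, ?_, ?_, ?_, fun h R => .parL R h⟩
  · intro P Q P' h hP
    obtain ⟨Y1, h1, ⟨-, h2⟩ | ⟨Y', h2, h3⟩⟩ := key h hP
    · exact ⟨Y1, h1, h2⟩
    · exact ⟨Y', h1.tail h2, h3⟩
  · rintro P Q a h ⟨M, P', hP⟩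
    obtain ⟨Y1, h1, ⟨h2, -⟩ | ⟨Y', h2, -⟩⟩ := key h hP
    · cases h2
    · exact ⟨Y1, h1, M, Y', h2⟩
  · rintro P Q a h ⟨k, M, P', hP⟩
    obtain ⟨Y1, h1, ⟨h2, -⟩ | ⟨Y', h2, -⟩⟩ := key h hP
    · cases h2
    · exact ⟨Y1, h1, k, M, Y', h2⟩

end EvalClosure

/-- The scope of `νf` in `νf.(f[Z] | f(Y).ā⟨Y⟩.0)`. -/
def cellBody (a : Name) (Z : Proc 0) : Proc 0 :=
  .par (.loc 0 (Z.renName Nat.succ)) (.inp 0 (.out (a + 1) (.var 0) .nil))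

/-- The scope of `νf` in `νf.(0 | ā⟨Z⟩.0)`. -/
def msgBody (a : Name) (Z : Proc 0) : Proc 0 :=
  .par .nil (.out (a + 1) (.quote (Z.renName Nat.succ)) .nil)

/-- `a(X).run(X)` -/
def receiver : Proc 0 := .inp 0 (.run (.var 0))

theorem not_hasFree_liftN_succ {k : ℕ} {M : Term 0} :
    ¬ (M.renName (liftN k Nat.succ)).HasFree k := by
  rw [Term.hasFree_renName]
  rintro ⟨y, -, hy⟩
  rw [liftN_succ, skipName] at hy
  split_ifs at hy <;> lia

theorem enter_cellBody (a : Name) (Z : Proc 0) (β : Act) :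
    β.enter (.par (.loc (0 + β.bn) (Z.renName (liftN β.bn Nat.succ)))
      ((β.ren Nat.succ).weaken (.inp 0 (.out (a + 1) (.var 0) .nil)))) =
    cellBody (a + β.bn) Z := by
  cases β with
  | tau => simp [Act.enter, Act.bn, Act.ren, Act.weaken, cellBody]
  | inp => simp [Act.enter, Act.bn, Act.ren, Act.weaken, cellBody]
  | out k b M =>
    have h1 : rotName k k = 0 := by simp [rotName]
    have h2 : rotName k (a + 1 + k) = a + k + 1 := by simp only [rotName]; split_ifs <;> lia
    simp [Act.enter, Act.bn, Act.ren, Act.weaken, cellBody, h1, h2, Proc.renName_renName,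
      liftN_succ, rotName_comp_skipName]

/-- The transitions of `νf.(f[Z] | f(Y).ā⟨Y⟩.0)`: either `Z` acts or it is passivated. -/
theorem step_cell_cases {a : Name} {Z U : Proc 0} {β : Act} (hU : Step (.nu (cellBody a Z)) β U) :
    (β = .tau ∧ U = .nu (msgBody a Z)) ∨
      ∃ Z', Step Z β Z' ∧ U = .nu (cellBody (a + β.bn) Z') := by
  rcases step_nu_cases hU with ⟨P', hT, rfl⟩ | ⟨k, b, M, rfl, hM, hT⟩
  · rcases step_par_cases hT with ⟨P', h, rfl⟩ | ⟨Q', h, rfl⟩ |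
      ⟨k, b, M, P', Q', hβ, h1, h2, rfl⟩ | ⟨k, b, M, P', Q', hβ, h1, h2, rfl⟩
    · rcases step_loc_iff.1 h with ⟨Z1, hZ, rfl⟩ | ⟨hβ, -⟩
      · obtain ⟨Z', hZ', rfl⟩ := hZ.of_renName Nat.succ_injective
        refine .inr ⟨Z', hZ', ?_⟩
        rw [Act.bn_ren, enter_cellBody]
      · cases β <;> simp [Act.ren] at hβ
    · obtain ⟨M, hβ, -⟩ := step_inp_iff.1 h
      cases β <;> simp [Act.ren] at hβ
    · have hβ : β = .tau := by cases β <;> simp [Act.ren] at hβ ⊢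
      subst hβ
      rw [renName_inp] at h2
      obtain ⟨M', hM, rfl⟩ := step_inp_iff.1 h2
      obtain ⟨hb, rfl⟩ : b = 0 ∧ M = M' := by simpa using hM
      subst hb
      rcases step_loc_iff.1 h1 with ⟨Z1, hZ, rfl⟩ | ⟨hβ, rfl⟩
      · obtain ⟨_, _, h0, -⟩ := hZ.out_of_renName Nat.succ_injective
        cases h0
      · obtain ⟨rfl, rfl⟩ : k = 0 ∧ M = _ := by simpa using hβ
        exact .inl ⟨rfl, by simp [Act.enter, nus, msgBody, Proc.subst, Proc.bind, Term.bind]⟩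
    · obtain ⟨M', hM, -⟩ := step_inp_iff.1 h2
      cases hM
  · rcases step_par_cases hT with ⟨P', h, rfl⟩ | ⟨Q', h, rfl⟩ |
      ⟨k, b, M, P', Q', hβ, h1, h2, rfl⟩ | ⟨k, b, M, P', Q', hβ, h1, h2, rfl⟩
    · rcases step_loc_iff.1 h with ⟨Z1, hZ, rfl⟩ | ⟨hβ, -⟩
      · obtain ⟨_, _, -, rfl⟩ := hZ.out_of_renName Nat.succ_injective
        exact (not_hasFree_liftN_succ hM).elim
      · simp at hβ
    · obtain ⟨M', hM, -⟩ := step_inp_iff.1 h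
      cases hM
    · cases hβ
    · cases hβ

theorem Step.cell {Z Z' : Proc 0} {β : Act} (h : Step Z β Z') (a : Name) :
    Step (.nu (cellBody a Z)) β (.nu (cellBody (a + β.bn) Z')) := by
  rw [← enter_cellBody]
  refine Step.guard (.parL _ (step_loc_iff.2 (.inl ⟨_, h.renName _, ?_⟩)))
  rw [Act.bn_ren]

theorem step_msg_cases {Z U : Proc 0} {β : Act} (hU : Step (.nu (msgBody 0 Z)) β U) :
    β = .out 0 0 (.quote Z) ∧ U = .nu (.par .nil .nil) := by
  rcases step_nu_cases hU with ⟨P', hT, rfl⟩ | ⟨k, b, M, rfl, hM, hT⟩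
  · rcases step_par_cases hT with ⟨P', h, rfl⟩ | ⟨Q', h, rfl⟩ |
      ⟨k, b, M, P', Q', hβ, h1, h2, rfl⟩ | ⟨k, b, M, P', Q', hβ, h1, h2, rfl⟩
    · exact (not_step_nil h).elim
    · obtain ⟨hβ, rfl⟩ := step_out_iff.1 h
      cases β with
      | tau => cases hβ
      | inp => cases hβ
      | out k b M =>
        simp only [Act.ren, Act.out.injEq] at hβ
        obtain ⟨rfl, hb, hM⟩ := hβ
        obtain rfl : b = 0 := by simpa using hb
        cases M with
        | var x => exact x.elim0
        | quote P =>
          rw [liftN_zero, renName_quote, Term.quote.injEq] at hM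
          have e : Nat.pred ∘ Nat.succ = id := rfl
          have := congrArg (Proc.renName · Nat.pred) hM
          simp only [Proc.renName_renName, e, Proc.renName_id] at this
          subst this
          simp [Act.enter, Act.ren]
    · exact (not_step_nil h1).elim
    · rw [renName_nil] at h1; exact (not_step_nil h1).elim
  · rcases step_par_cases hT with ⟨P', h, rfl⟩ | ⟨Q', h, rfl⟩ |
      ⟨k, b, M, P', Q', hβ, h1, h2, rfl⟩ | ⟨k, b, M, P', Q', hβ, h1, h2, rfl⟩
    · exact (not_step_nil h).elim
    · obtain ⟨hβ, rfl⟩ := step_out_iff.1 h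
      obtain ⟨rfl, -, rfl⟩ := Act.out.inj hβ
      rw [← renName_quote, ← liftN_zero Nat.succ] at hM
      exact (not_hasFree_liftN_succ hM).elim
    · cases hβ
    · cases hβ

theorem step_msg (Z : Proc 0) :
    Step (.nu (msgBody 0 Z)) (.out 0 0 (.quote Z)) (.nu (.par .nil .nil)) := by
  have := Step.guard (α := .out 0 0 (.quote Z)) (P := msgBody 0 Z)
    (.parR _ (step_out_iff.2 ⟨by simp [Act.ren], rfl⟩))
  simpa [Act.enter, Act.ren] using this

theorem not_step_dead {U : Proc 0} {β : Act} (hU : Step (.nu (.par .nil .nil)) β U) : False := by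
  rcases step_nu_cases hU with ⟨P', hT, -⟩ | ⟨k, b, M, -, hM, hT⟩ <;>
  rcases step_par_cases hT with ⟨P', h, -⟩ | ⟨Q', h, -⟩ |
      ⟨k, b, M, P', Q', hβ, h, h2, -⟩ | ⟨k, b, M, P', Q', hβ, h1, h, -⟩ <;>
  exact not_step_nil h

theorem step_receiver {U : Proc 0} {β : Act} (h : Step receiver β U) :
    ∃ N, β = .inp 0 N ∧ U = .run N := by
  obtain ⟨N, rfl, rfl⟩ := step_inp_iff.1 h
  exact ⟨N, rfl, by simp [Proc.subst, Proc.bind, Term.bind]⟩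

/-- The idle contents of a cell. -/
inductive IdleCode : Proc 0 → Prop
  | receiver : IdleCode receiver
  | run {Z : Proc 0} (h : IdleCode Z) : IdleCode (.run (.quote Z))

/-- The contents of a cell that holds the process `P`. -/
inductive LiveCode (P : Proc 0) : Proc 0 → Prop
  | self : LiveCode P (P.renName Nat.succ)
  | run {Z : Proc 0} (h : LiveCode P Z) : LiveCode P (.run (.quote Z))

/-- Parallel compositions of server components that hold only idle contents; the flag says whether
the replicated cell is among them. -/
inductive Quiet : Bool → Proc 0 → Prop
  | nil : Quiet false .nil
  | dead : Quiet false (.nu (.par .nil .nil))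
  | cell {Z : Proc 0} (h : IdleCode Z) : Quiet false (.nu (cellBody 0 Z))
  | msg {Z : Proc 0} (h : IdleCode Z) : Quiet false (.nu (msgBody 0 Z))
  | bang : Quiet true (.bang (.nu (cellBody 0 receiver)))
  | par {b b' : Bool} {P Q : Proc 0} (hP : Quiet b P) (hQ : Quiet b' Q) :
      Quiet (b || b') (.par P Q)

/-- Parallel compositions of server components one of which holds the process `P`. -/
inductive Live (P : Proc 0) : Bool → Proc 0 → Prop
  | out {Z : Proc 0} (h : LiveCode P Z) : Live P false (.out 0 (.quote Z) .nil)
  | msg {Z : Proc 0} (h : LiveCode P Z) : Live P false (.nu (msgBody 0 Z))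
  | cell {Z : Proc 0} (h : LiveCode P Z) : Live P false (.nu (cellBody 0 Z))
  | parL {b b' : Bool} {T Q : Proc 0} (hT : Live P b T) (hQ : Quiet b' Q) :
      Live P (b || b') (.par T Q)
  | parR {b b' : Bool} {T Q : Proc 0} (hQ : Quiet b Q) (hT : Live P b' T) :
      Live P (b || b') (.par Q T)

theorem IdleCode.free {Z : Proc 0} (h : IdleCode Z) {x : Name} (hx : Z.HasFree x) : x = 0 := by
  induction h with
  | receiver => simpa [HOpiP.receiver, Proc.HasFree, Term.HasFree] using hx
  | run _ ih => exact ih (by simpa [Proc.HasFree, Term.HasFree] using hx)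

theorem Quiet.free {b : Bool} {Q : Proc 0} (h : Quiet b Q) {x : Name} (hx : Q.HasFree x) :
    x = 0 := by
  induction h with
  | nil => simp [Proc.HasFree] at hx
  | dead => simp [Proc.HasFree] at hx
  | cell h =>
    simp only [cellBody, Proc.HasFree, Proc.hasFree_renName, Term.HasFree] at hx
    rcases hx with (hx | ⟨y, hy, hx⟩) | hx
    · lia
    · have := h.free hy; lia
    · simpa using hx
  | msg h =>
    simp only [msgBody, Proc.HasFree, Proc.hasFree_renName, Term.HasFree] at hx
    rcases hx with hx | hx | ⟨y, hy, hx⟩ | hx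
    · exact hx.elim
    · simpa using hx
    · have := h.free hy; lia
    · exact hx.elim
  | bang =>
    simp only [cellBody, receiver, renName_inp, renName_run, renName_var, Proc.HasFree,
      Term.HasFree] at hx
    simpa using hx
  | par _ _ ihP ihQ => exact hx.elim ihP ihQ

theorem Quiet.renName_eq {b : Bool} {Q : Proc 0} (h : Quiet b Q) {ρ : Name → Name}
    (hρ : ρ 0 = 0) : Q.renName ρ = Q :=
  Proc.renName_eq_self fun x hx => by rw [h.free hx, hρ]

theorem IdleCode.step {Z Z' : Proc 0} {β : Act} (h : IdleCode Z) (hZ : Step Z β Z') :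
    (β = .tau ∧ IdleCode Z') ∨ ∃ N, β = .inp 0 N ∧ Z' = .run N := by
  cases h with
  | receiver => exact .inr (step_receiver hZ)
  | run h =>
    obtain ⟨rfl, rfl⟩ := step_run_quote_iff.1 hZ
    exact .inl ⟨rfl, h⟩

/-- What a quiet composition may do. -/
def QuietPost (b : Bool) : Act → Proc 0 → Prop
  | .tau, U => Quiet b U
  | .inp c N, U => c = 0 ∧ ∀ Z, N = .quote Z →
      (IdleCode Z → Quiet b U) ∧ ∀ P, LiveCode P Z → Live P b U
  | .out k c N, U => k = 0 ∧ c = 0 ∧ ∃ Z, N = .quote Z ∧ IdleCode Z ∧ Quiet b U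

theorem Quiet.step_nu {b : Bool} {Q U : Proc 0} {β : Act} (hQ : Quiet b (.nu Q))
    (hU : Step (.nu Q) β U) : QuietPost b β U := by
  cases hQ with
  | dead => exact (not_step_dead hU).elim
  | cell hZ =>
    rcases step_cell_cases hU with ⟨rfl, rfl⟩ | ⟨Z', hS, rfl⟩
    · exact .msg hZ
    · rcases hZ.step hS with ⟨rfl, h⟩ | ⟨N, rfl, rfl⟩
      · exact .cell h
      · refine ⟨rfl, fun Z hN => ?_⟩
        subst hN
        exact ⟨fun h => .cell (.run h), fun P h => .cell (.run h)⟩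
  | msg hZ =>
    obtain ⟨rfl, rfl⟩ := step_msg_cases hU
    exact ⟨rfl, rfl, _, rfl, hZ, .dead⟩

theorem Quiet.step {b : Bool} {Q U : Proc 0} {β : Act} (hQ : Quiet b Q) (h : Step Q β U) :
    QuietPost b β U := by
  induction h generalizing b with
  | hoIn | hoOut | transp | passiv | run => cases hQ
  | guardTau h => exact hQ.step_nu (.guardTau h)
  | guardIn h => exact hQ.step_nu (.guardIn h)
  | guardOut h => exact hQ.step_nu (.guardOut h)
  | extr h hM => exact hQ.step_nu (.extr h hM)
  | rep h ih =>
    cases hQ with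
    | bang => exact ih (.par .bang (.cell .receiver))
  | @parL _ _ α _ h ih =>
    cases hQ with
    | par h1 h2 =>
      have := ih h1
      cases α with
      | tau => exact .par this h2
      | inp c N =>
        refine ⟨this.1, fun Z hN => ?_⟩
        have := this.2 Z hN
        exact ⟨fun h => .par (this.1 h) h2, fun P h => .parL (this.2 P h) h2⟩
      | out k c N =>
        obtain ⟨rfl, rfl, Z, rfl, hZ, h⟩ := this
        exact ⟨rfl, rfl, Z, rfl, hZ, .par h (by simpa using h2)⟩
  | @parR _ _ α _ h ih =>
    cases hQ with
    | par h1 h2 =>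
      have := ih h2
      cases α with
      | tau => exact .par h1 this
      | inp c N =>
        refine ⟨this.1, fun Z hN => ?_⟩
        have := this.2 Z hN
        exact ⟨fun h => .par h1 (this.1 h), fun P h => .parR h1 (this.2 P h)⟩
      | out k c N =>
        obtain ⟨rfl, rfl, Z, rfl, hZ, h⟩ := this
        exact ⟨rfl, rfl, Z, rfl, hZ, .par (by simpa using h1) h⟩
  | reactL _ _ ihP ihQ =>
    cases hQ with
    | par h1 h2 =>
      obtain ⟨rfl, rfl, Z, rfl, hZ, h⟩ := ihP h1
      exact .par h (((ihQ (by simpa using h2)).2 Z rfl).1 hZ)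
  | reactR _ _ ihP ihQ =>
    cases hQ with
    | par h1 h2 =>
      obtain ⟨rfl, rfl, Z, rfl, hZ, h⟩ := ihQ h2
      exact .par (((ihP (by simpa using h1)).2 Z rfl).1 hZ) h

/-- What a composition holding `P` may do; in the last case `P` acts. -/
inductive LivePost (P : Proc 0) (b : Bool) (U : Proc 0) : Act → Prop
  | tau (h : Live P b U) : LivePost P b U .tau
  | inp {N : Term 0} (h : ∀ Z, N = .quote Z → IdleCode Z → Live P b U) : LivePost P b U (.inp 0 N)
  | outIdle {Z : Proc 0} (hZ : IdleCode Z) (h : Live P b U) : LivePost P b U (.out 0 0 (.quote Z))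
  | outLive {Z : Proc 0} (hZ : LiveCode P Z) (h : Quiet b U) :
      LivePost P b U (.out 0 0 (.quote Z))
  | act {β : Act} (hin : ∀ N, β ≠ .inp 0 N)
      (hout : ∀ k x N, β = .out k x N → x ≠ 0 ∧ ∃ M : Term 0, N = M.renName (liftN k Nat.succ))
      (h : ∀ α, β = α.ren Nat.succ → ∃ P', Step P α P' ∧ Live P' b (α.enter U)) :
      LivePost P b U β

theorem enter_cell_renName (α : Act) (P : Proc 0) :
    α.enter (.nu (cellBody (0 + α.bn) (P.renName (liftN α.bn Nat.succ)))) =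
      .nu (cellBody 0 (P.renName Nat.succ)) := by
  cases α with
  | tau => simp [Act.enter, Act.bn]
  | inp => simp [Act.enter, Act.bn]
  | out k b M =>
    have e : liftName (rotName k) ∘ Nat.succ ∘ skipName k = Nat.succ ∘ Nat.succ := by
      rw [← Function.comp_assoc, liftName_comp_succ, Function.comp_assoc, rotName_comp_skipName]
    have h1 : rotName k k = 0 := by simp [rotName]
    simp [Act.enter, Act.bn, cellBody, Proc.renName_renName, liftN_succ, e, h1]

theorem enter_par_quietR (α : Act) (T : Proc 0) {b : Bool} {Q : Proc 0} (hQ : Quiet b Q) :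
    α.enter (.par T ((α.ren Nat.succ).weaken Q)) = .par (α.enter T) Q := by
  cases α with
  | tau => rfl
  | inp => rfl
  | out k c M =>
    simp only [Act.enter, Act.ren, Act.weaken, renName_par, Proc.renName_renName]
    rw [hQ.renName_eq]
    simp [rotName]

theorem enter_par_quietL (α : Act) (T : Proc 0) {b : Bool} {Q : Proc 0} (hQ : Quiet b Q) :
    α.enter (.par ((α.ren Nat.succ).weaken Q) T) = .par Q (α.enter T) := by
  cases α with
  | tau => rfl
  | inp => rfl
  | out k c M =>
    simp only [Act.enter, Act.ren, Act.weaken, renName_par, Proc.renName_renName]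
    rw [hQ.renName_eq]
    simp [rotName]

theorem Quiet.inp_channel {b : Bool} {Q U : Proc 0} {k : ℕ} {c : Name} {N : Term 0}
    (hQ : Quiet b Q) (h : Step (Q.renName (· + k)) (.inp (c + k) N) U) : c = 0 := by
  obtain ⟨y, hy, hc⟩ := Proc.hasFree_renName.1 (h.free.1 _ rfl)
  have := hQ.free hy
  lia

theorem Live.step {P T U : Proc 0} {b : Bool} {β : Act} (hT : Live P b T) (hU : Step T β U) :
    LivePost P b U β := by
  induction hT generalizing β U with
  | out hZ =>
    obtain ⟨rfl, rfl⟩ := step_out_iff.1 hU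
    exact .outLive hZ .nil
  | msg hZ =>
    obtain ⟨rfl, rfl⟩ := step_msg_cases hU
    exact .outLive hZ .dead
  | cell hZ =>
    rcases step_cell_cases hU with ⟨rfl, rfl⟩ | ⟨Z', hS, rfl⟩
    · exact .tau (.msg hZ)
    cases hZ with
    | run hZ =>
      obtain ⟨rfl, rfl⟩ := step_run_quote_iff.1 hS
      exact .tau (.cell hZ)
    | self =>
      refine .act ?_ ?_ ?_
      · rintro N rfl
        obtain ⟨a, ha⟩ := hS.inp_of_renName
        cases ha
      · rintro k x N rfl
        obtain ⟨a, M, rfl, rfl⟩ := hS.out_of_renName Nat.succ_injective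
        exact ⟨Nat.succ_ne_zero a, M, rfl⟩
      · rintro α rfl
        obtain ⟨P', hP, rfl⟩ := hS.of_renName Nat.succ_injective
        refine ⟨P', hP, ?_⟩
        rw [Act.bn_ren, enter_cell_renName]
        exact .cell .self
  | @parL b b' T Q hT hQ ih =>
    rcases step_par_cases hU with ⟨T', hS, rfl⟩ | ⟨Q', hS, rfl⟩ |
      ⟨k, c, M, T', Q', rfl, h1, h2, rfl⟩ | ⟨k, c, M, T', Q', rfl, h1, h2, rfl⟩
    · cases ih hS with
      | tau hL => exact .tau (.parL hL hQ)
      | inp hL => exact .inp fun Z hN hZ => .parL (hL Z hN hZ) hQ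
      | outIdle hZ hL => exact .outIdle hZ (.parL hL (by simpa using hQ))
      | outLive hZ hL => exact .outLive hZ (.par hL (by simpa using hQ))
      | act hin hout h =>
        refine .act hin hout fun α hα => ?_
        subst hα
        obtain ⟨P', hP, h⟩ := h α rfl
        refine ⟨P', hP, ?_⟩
        rw [enter_par_quietR α T' hQ]
        exact .parL h hQ
    · have := hQ.step hS
      cases β with
      | tau => exact .tau (.parL hT this)
      | inp c N =>
        obtain ⟨rfl, this⟩ := this
        exact .inp fun Z hN hZ => .parL hT ((this Z hN).1 hZ)
      | out k c N =>
        obtain ⟨rfl, rfl, Z, rfl, hZ, h⟩ := this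
        exact .outIdle hZ (.parL (by simpa using hT) h)
    · obtain rfl := hQ.inp_channel h2
      cases ih h1 with
      | outIdle hZ hL =>
        rw [Proc.renName_add_zero] at h2
        exact .tau (.parL hL (((hQ.step h2).2 _ rfl).1 hZ))
      | outLive hZ hL =>
        rw [Proc.renName_add_zero] at h2
        exact .tau (.parR hL (((hQ.step h2).2 _ rfl).2 _ hZ))
      | act _ hout _ => exact ((hout _ _ _ rfl).1 rfl).elim
    · obtain ⟨rfl, rfl, Z, rfl, hZ, h⟩ := hQ.step h2
      rw [Proc.renName_add_zero] at h1
      cases ih h1 with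
      | inp h3 => exact .tau (.parL (h3 Z rfl hZ) h)
      | act hin _ _ => exact (hin _ rfl).elim
  | @parR b b' T Q hQ hT ih =>
    rcases step_par_cases hU with ⟨Q', hS, rfl⟩ | ⟨T', hS, rfl⟩ |
      ⟨k, c, M, Q', T', rfl, h2, h1, rfl⟩ | ⟨k, c, M, Q', T', rfl, h2, h1, rfl⟩
    · have := hQ.step hS
      cases β with
      | tau => exact .tau (.parR this hT)
      | inp c N =>
        obtain ⟨rfl, this⟩ := this
        exact .inp fun Z hN hZ => .parR ((this Z hN).1 hZ) hT
      | out k c N =>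
        obtain ⟨rfl, rfl, Z, rfl, hZ, h⟩ := this
        exact .outIdle hZ (.parR h (by simpa using hT))
    · cases ih hS with
      | tau hL => exact .tau (.parR hQ hL)
      | inp hL => exact .inp fun Z hN hZ => .parR hQ (hL Z hN hZ)
      | outIdle hZ hL => exact .outIdle hZ (.parR (by simpa using hQ) hL)
      | outLive hZ hL => exact .outLive hZ (.par (by simpa using hQ) hL)
      | act hin hout h =>
        refine .act hin hout fun α hα => ?_
        subst hα
        obtain ⟨P', hP, h⟩ := h α rfl
        refine ⟨P', hP, ?_⟩
        rw [enter_par_quietL α T' hQ]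
        exact .parR hQ h
    · obtain ⟨rfl, rfl, Z, rfl, hZ, h⟩ := hQ.step h2
      rw [Proc.renName_add_zero] at h1
      cases ih h1 with
      | inp h3 => exact .tau (.parR h (h3 Z rfl hZ))
      | act hin _ _ => exact (hin _ rfl).elim
    · obtain rfl := hQ.inp_channel h2
      cases ih h1 with
      | outIdle hZ hL =>
        rw [Proc.renName_add_zero] at h2
        exact .tau (.parR (((hQ.step h2).2 _ rfl).1 hZ) hL)
      | outLive hZ hL =>
        rw [Proc.renName_add_zero] at h2
        exact .tau (.parL (((hQ.step h2).2 _ rfl).2 _ hZ) hL)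
      | act _ hout _ => exact ((hout _ _ _ rfl).1 rfl).elim

theorem LiveCode.renName {P Z : Proc 0} (h : LiveCode P Z) (ρ : Name → Name) :
    LiveCode (P.renName ρ) (Z.renName (liftName ρ)) := by
  induction h with
  | self =>
    rw [Proc.renName_renName, liftName_comp_succ, ← Proc.renName_renName]
    exact .self
  | run _ ih => simpa using .run ih

theorem Live.renName {P T : Proc 0} {b : Bool} (h : Live P b T) (ρ : Name → Name) :
    Live (P.renName ρ) b (T.renName (liftName ρ)) := by
  have e : liftName (liftName ρ) ∘ Nat.succ = Nat.succ ∘ liftName ρ := liftName_comp_succ _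
  induction h with
  | out hZ => simpa using .out (hZ.renName ρ)
  | msg hZ =>
    have := Live.msg (hZ.renName ρ)
    simpa [msgBody, Proc.renName_renName, e] using this
  | cell hZ =>
    have := Live.cell (hZ.renName ρ)
    simpa [cellBody, Proc.renName_renName, e] using this
  | parL _ hQ ih =>
    rw [renName_par, hQ.renName_eq rfl]
    exact .parL ih hQ
  | parR hQ _ ih =>
    rw [renName_par, hQ.renName_eq rfl]
    exact .parR hQ ih

/-- The states of `Live` in which the process held is running in its cell. -/
inductive Running (P : Proc 0) : Bool → Proc 0 → Prop
  | cell : Running P false (.nu (cellBody 0 (P.renName Nat.succ)))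
  | parL {b b' : Bool} {T Q : Proc 0} (hT : Running P b T) (hQ : Quiet b' Q) :
      Running P (b || b') (.par T Q)
  | parR {b b' : Bool} {T Q : Proc 0} (hQ : Quiet b Q) (hT : Running P b' T) :
      Running P (b || b') (.par Q T)

theorem Running.live {P T : Proc 0} {b : Bool} (h : Running P b T) : Live P b T := by
  induction h with
  | cell => exact .cell .self
  | parL _ hQ ih => exact .parL ih hQ
  | parR hQ _ ih => exact .parR hQ ih

theorem Running.renName {P T : Proc 0} {b : Bool} (h : Running P b T) (ρ : Name → Name) :
    Running (P.renName ρ) b (T.renName (liftName ρ)) := by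
  have e : liftName (liftName ρ) ∘ Nat.succ ∘ Nat.succ = Nat.succ ∘ liftName ρ ∘ Nat.succ := rfl
  induction h with
  | cell =>
    have := Running.cell (P := P.renName ρ)
    rw [Proc.renName_renName, ← liftName_comp_succ, ← Proc.renName_renName] at this
    simpa [cellBody, Proc.renName_renName, e] using this
  | parL _ hQ ih =>
    rw [renName_par, hQ.renName_eq rfl]
    exact .parL ih hQ
  | parR hQ _ ih =>
    rw [renName_par, hQ.renName_eq rfl]
    exact .parR hQ ih

theorem Running.step {P P' T : Proc 0} {b : Bool} {α : Act} (h : Running P b T)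
    (hP : Step P α P') : ∃ U, Step T (α.ren Nat.succ) U ∧ Running P' b (α.enter U) := by
  induction h with
  | cell =>
    refine ⟨_, (hP.renName Nat.succ).cell 0, ?_⟩
    rw [Act.bn_ren, enter_cell_renName]
    exact .cell
  | parL _ hQ ih =>
    obtain ⟨U, h, hU⟩ := ih
    refine ⟨_, .parL _ h, ?_⟩
    rw [enter_par_quietR α U hQ]
    exact .parL hU hQ
  | parR hQ _ ih =>
    obtain ⟨U, h, hU⟩ := ih
    refine ⟨_, .parR _ h, ?_⟩
    rw [enter_par_quietL α U hQ]
    exact .parR hQ hU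

theorem LiveCode.weak {P Z : Proc 0} (h : LiveCode P Z) :
    Weak (.nu (cellBody 0 Z)) (.nu (cellBody 0 (P.renName Nat.succ))) := by
  induction h with
  | self => exact .refl
  | run _ ih => exact .head ((Step.run _).cell 0) ih

/-- A composition that holds `P` can run `P` or send its code. -/
theorem Live.run_or_send {P T : Proc 0} {b : Bool} (h : Live P b T) :
    (∃ T', Weak T T' ∧ Running P b T') ∨
      ∃ Z T', LiveCode P Z ∧ Step T (.out 0 0 (.quote Z)) T' ∧ Quiet b T' := by
  induction h with
  | out h => exact .inr ⟨_, _, h, .hoOut _ _ _, .nil⟩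
  | msg h => exact .inr ⟨_, _, h, step_msg _, .dead⟩
  | cell h => exact .inl ⟨_, h.weak, .cell⟩
  | parL _ hQ ih =>
    rcases ih with ⟨T', h, hT'⟩ | ⟨Z, T', hZ, h, hT'⟩
    · exact .inl ⟨_, h.parL _, .parL hT' hQ⟩
    · refine .inr ⟨Z, _, hZ, .parL _ h, ?_⟩
      rw [Act.weaken_out_zero]
      exact .par hT' hQ
  | parR hQ _ ih =>
    rcases ih with ⟨T', h, hT'⟩ | ⟨Z, T', hZ, h, hT'⟩
    · exact .inl ⟨_, h.parR _, .parR hQ hT'⟩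
    · refine .inr ⟨Z, _, hZ, .parR _ h, ?_⟩
      rw [Act.weaken_out_zero]
      exact .par hQ hT'

/-- The replicated cell can receive code and run it. -/
theorem Quiet.receive {b : Bool} {Q P Z : Proc 0} (hQ : Quiet b Q) (hb : b = true)
    (hZ : LiveCode P Z) :
    ∃ Q' Q'', Step Q (.inp 0 (.quote Z)) Q' ∧ Weak Q' Q'' ∧ Running P true Q'' := by
  induction hQ with
  | nil | dead | cell | msg => cases hb
  | bang =>
    have h : Step receiver (.inp 0 (.quote Z)) (.run (.quote Z)) :=
      step_inp_iff.2 ⟨_, rfl, by simp [Proc.subst, Proc.bind, Term.bind]⟩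
    exact ⟨_, _, .rep (.parR _ (h.cell 0)), hZ.run.weak.parR _, .parR .bang .cell⟩
  | @par b b' _ _ hP hQ ihP ihQ =>
    cases b with
    | true =>
      obtain ⟨Q', Q'', h1, h2, h3⟩ := ihP rfl
      exact ⟨_, _, .parL _ h1, h2.parL _, .parL h3 hQ⟩
    | false =>
      cases b' with
      | true =>
        obtain ⟨Q', Q'', h1, h2, h3⟩ := ihQ rfl
        exact ⟨_, _, .parR _ h1, h2.parR _, .parR hP h3⟩
      | false => cases hb

theorem Live.exists_running {P T : Proc 0} {b : Bool} (h : Live P b T) (hb : b = true) :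
    ∃ T', Weak T T' ∧ Running P true T' := by
  induction h with
  | out | msg | cell => cases hb
  | @parL b b' T Q hT hQ ih =>
    rcases hT.run_or_send with ⟨T', h, hT'⟩ | ⟨Z, T', hZ, h, hT'⟩
    · exact ⟨_, h.parL _, hb ▸ .parL hT' hQ⟩
    cases b with
    | true =>
      obtain ⟨T', h, hT'⟩ := ih rfl
      exact ⟨_, h.parL _, .parL hT' hQ⟩
    | false =>
      obtain ⟨Q', Q'', h1, h2, h3⟩ := hQ.receive (by simpa using hb) hZ
      exact ⟨_, .head (.reactL h (by simpa using h1)) (h2.parR _), .parR hT' h3⟩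
  | @parR b b' T Q hQ hT ih =>
    rcases hT.run_or_send with ⟨T', h, hT'⟩ | ⟨Z, T', hZ, h, hT'⟩
    · exact ⟨_, h.parR _, hb ▸ .parR hQ hT'⟩
    cases b with
    | true =>
      obtain ⟨Q', Q'', h1, h2, h3⟩ := hQ.receive rfl hZ
      exact ⟨_, .head (.reactR (by simpa using h1) h) (h2.parL _), .parL h3 hT'⟩
    | false =>
      obtain ⟨T', h, hT'⟩ := ih (by simpa using hb)
      exact ⟨_, h.parR _, .parR hQ hT'⟩

/-- `c(X).run(X)` -/
def runInput (c : Name) : Proc 0 := .inp c (.run (.var 0))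

/-- `c(X).νa.(ā⟨X⟩.0 | !νf.(f[a(X).run(X)] | f(Y).ā⟨Y⟩.0))` -/
def serverInput (c : Name) : Proc 0 :=
  .inp c (.nu (.par
    (.out 0 (.var 0) .nil)
    (.bang (.nu (.par
      (.loc 0 (.inp 1 (.run (.var 0))))
      (.inp 0 (.out 1 (.var 0) .nil)))))))

theorem runInput_renName (c : Name) (ρ : Name → Name) :
    (runInput c).renName ρ = runInput (ρ c) := by
  simp [runInput]

theorem serverInput_renName (c : Name) (ρ : Name → Name) :
    (serverInput c).renName ρ = serverInput (ρ c) := by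
  simp [serverInput]

theorem step_runInput_iff {c : Name} {α : Act} {U : Proc 0} :
    Step (runInput c) α U ↔ ∃ P, α = .inp c (.quote P) ∧ U = .run (.quote P) := by
  rw [runInput, step_inp_iff]
  constructor
  · rintro ⟨M, rfl, rfl⟩
    cases M with
    | var x => exact x.elim0
    | quote P => exact ⟨P, rfl, by simp [Proc.subst, Proc.bind, Term.bind]⟩
  · rintro ⟨P, rfl, rfl⟩
    exact ⟨_, rfl, by simp [Proc.subst, Proc.bind, Term.bind]⟩

/-- The server after the receipt of the code of `P`. -/
def serverInit (P : Proc 0) : Proc 0 :=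
  .par (.out 0 (.quote (P.renName Nat.succ)) .nil) (.bang (.nu (cellBody 0 receiver)))

theorem serverInit_live (P : Proc 0) : Live P true (serverInit P) :=
  .parL (.out .self) .bang

theorem step_serverInput_iff {c : Name} {α : Act} {U : Proc 0} :
    Step (serverInput c) α U ↔ ∃ P, α = .inp c (.quote P) ∧ U = .nu (serverInit P) := by
  rw [serverInput, step_inp_iff]
  constructor
  · rintro ⟨M, rfl, rfl⟩
    cases M with
    | var x => exact x.elim0
    | quote P =>
      exact ⟨P, rfl, by
        simp [Proc.subst, Proc.bind, Term.bind, serverInit, cellBody, receiver]⟩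
  · rintro ⟨P, rfl, rfl⟩
    exact ⟨_, rfl, by
      simp [Proc.subst, Proc.bind, Term.bind, serverInit, cellBody, receiver]⟩

/-- A process and the server that holds it. -/
inductive Served : Proc 0 → Proc 0 → Prop
  | init (c : Name) : Served (runInput c) (serverInput c)
  | ready {P T : Proc 0} (h : Live P true T) : Served (.run (.quote P)) (.nu T)
  | live {P T : Proc 0} (h : Live P true T) : Served P (.nu T)

/-- Pairs of related processes the first of which is matched directly by the second. -/
inductive Synced : Proc 0 → Proc 0 → Prop
  | initL (c : Name) : Synced (runInput c) (serverInput c)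
  | initR (c : Name) : Synced (serverInput c) (runInput c)
  | ready {P T : Proc 0} (h : Live P true T) : Synced (.run (.quote P)) (.nu T)
  | running {P T : Proc 0} (h : Running P true T) : Synced P (.nu T)
  | server {P T : Proc 0} (h : Live P true T) : Synced (.nu T) P

theorem Served.renName {X Y : Proc 0} (ρ : Name → Name) (h : Served X Y) :
    Served (X.renName ρ) (Y.renName ρ) := by
  cases h with
  | init c => rw [runInput_renName, serverInput_renName]; exact .init _
  | ready h => rw [renName_run, renName_quote, renName_nu]; exact .ready (h.renName ρ)
  | live h => rw [renName_nu]; exact .live (h.renName ρ)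

theorem Synced.renName {X Y : Proc 0} (ρ : Name → Name) (h : Synced X Y) :
    Synced (X.renName ρ) (Y.renName ρ) := by
  cases h with
  | initL c => rw [runInput_renName, serverInput_renName]; exact .initL _
  | initR c => rw [runInput_renName, serverInput_renName]; exact .initR _
  | ready h => rw [renName_run, renName_quote, renName_nu]; exact .ready (h.renName ρ)
  | running h => rw [renName_nu]; exact .running (h.renName ρ)
  | server h => rw [renName_nu]; exact .server (h.renName ρ)

theorem Synced.served {X Y : Proc 0} (h : Synced X Y) : Served X Y ∨ Served Y X := by
  cases h with
  | initL c => exact .inl (.init c)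
  | initR c => exact .inr (.init c)
  | ready h => exact .inl (.ready h)
  | running h => exact .inl (.live h.live)
  | server h => exact .inr (.live h)

theorem exists_synced {X Y : Proc 0} (h : Served X Y ∨ Served Y X) :
    ∃ Y', Weak Y Y' ∧ Synced X Y' := by
  rcases h with h | h
  · cases h with
    | init c => exact ⟨_, .refl, .initL c⟩
    | ready h => exact ⟨_, .refl, .ready h⟩
    | live h =>
      obtain ⟨T', h1, h2⟩ := h.exists_running rfl
      exact ⟨_, h1.nu, .running h2⟩
  · cases h with
    | init c => exact ⟨_, .refl, .initR c⟩
    | ready h => exact ⟨_, .single (.run _), .server h⟩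
    | live h => exact ⟨_, .refl, .server h⟩

theorem Synced.step {X Y X' : Proc 0} {α : Act} (h : Synced X Y) (hX : Step X α X') :
    EvalClosure.Matches Y α (fun Y' => Served X' Y' ∨ Served Y' X') := by
  cases h with
  | initL c =>
    obtain ⟨P, rfl, rfl⟩ := step_runInput_iff.1 hX
    exact .inr ⟨_, step_serverInput_iff.2 ⟨P, rfl, rfl⟩, .inl (.ready (serverInit_live P))⟩
  | initR c =>
    obtain ⟨P, rfl, rfl⟩ := step_serverInput_iff.1 hX
    exact .inr ⟨_, step_runInput_iff.2 ⟨P, rfl, rfl⟩, .inr (.ready (serverInit_live P))⟩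
  | ready h =>
    obtain ⟨rfl, rfl⟩ := step_run_quote_iff.1 hX
    exact .inl ⟨rfl, .inl (.live h)⟩
  | running h =>
    obtain ⟨U, h1, h2⟩ := h.step hX
    exact .inr ⟨_, h1.guard, .inl (.live h2.live)⟩
  | server h =>
    rcases step_nu_cases hX with ⟨U, hU, rfl⟩ | ⟨k, a, M, rfl, hM, hU⟩
    · have key : (α = .tau ∧ Live Y true U) ∨
          ∃ P', Step Y α P' ∧ Live P' true (α.enter U) := by
        generalize hβ : α.ren Nat.succ = β at hU
        cases h.step hU with
        | tau h => exact .inl ⟨by cases α <;> simp_all [Act.ren], h⟩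
        | inp => cases α <;> simp [Act.ren] at hβ
        | outIdle => cases α <;> simp [Act.ren] at hβ
        | outLive => cases α <;> simp [Act.ren] at hβ
        | act _ _ h => exact .inr (h α hβ.symm)
      rcases key with ⟨rfl, h⟩ | ⟨P', hP, h⟩
      · exact .inl ⟨rfl, .inr (.live h)⟩
      · exact .inr ⟨P', hP, .inr (.live h)⟩
    · generalize hβ : Act.out k (a + 1) M = β at hU
      cases h.step hU with
      | tau | inp => cases hβ
      | outIdle => simp at hβ
      | outLive => simp at hβ
      | act _ hout _ =>
        obtain ⟨-, M', rfl⟩ := hout _ _ _ hβ.symm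
        exact (not_hasFree_liftN_succ hM).elim

end HOpiP

/-- `c(X).run(X) ≈ c(X).νa.(ā⟨X⟩.0 | !νf.(f[a(X).run(X)] | f(Y).ā⟨Y⟩.0))`.  The index of `a` is
`0` directly under `νa` and `1` under `νf`; the index of `f` is `0`; each variable that occurs is
bound by the innermost input around it and so has the index `0`. -/
theorem mainTheorem5 (c : HOpiP.Name) :
    HOpiP.BarbedEq
      (.inp c (.run (.var 0)))
      (.inp c (.nu (.par
        (.out 0 (.var 0) .nil)
        (.bang (.nu (.par
          (.loc 0 (.inp 1 (.run (.var 0))))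
          (.inp 0 (.out 1 (.var 0) .nil)))))))) := by
  refine ⟨_, HOpiP.EvalClosure.isRedClosedBarbed (A := HOpiP.Synced)
    (B := fun X Y => HOpiP.Served X Y ∨ HOpiP.Served Y X) Or.symm
    HOpiP.Synced.renName (fun ρ h => h.imp (.renName ρ) (.renName ρ)) HOpiP.Synced.served
    HOpiP.exists_synced HOpiP.Synced.step, .base (.inl (.init c))⟩
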